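/- Let $\mathbb{K}$ be a field, let $n\ge 0$, and let $G$ be a simple graph on the vertex set $[n]=\{1,\dots,n\}$. Let $S=\mathbb{K}[x_1,\dots,x_n,y_1,\dots,y_n]$, let $\mathfrak{m}=(x_1,\dots,x_n,y_1,\dots,y_n)$, and let $J_G\subseteq S$ be the binomial edge ideal of $G$, i.e. the ideal generated by the binomials $x_iy_j-x_jy_i$ with $\{i,j\}\in E(G)$ and $i<j$. Write $$\operatorname{depth} S/J_G=\min\{i : H^i_{\mathfrak m}(S/J_G)\neq 0\},$$ where $H^i_{\mathfrak m}$ denotes local cohomology with support in $\mathfrak m$. A vertex $v$ of $G$ is called free (or simplicial) if any two distinct neighbours of $v$ are adjacent; let $f(G)$ be the number of free vertices of $G$. Let $G_1,\dots,G_t$ be the connected components of $G$, let $\mathfrak{i}(G)$ be the number of isolated vertices of $G$, and put $$d(G)=\mathfrak{i}(G)+\sum_{k=1}^{t}\operatorname{diam}(G_k),\qquad \xi(G)=f(G)+d(G),$$ where the diameter of a connected graph is the largest distance between two of its vertices. Then $$\operatorname{depth} S/J_G\ \ge\ \xi(G).$$ In particular, if $G$ is connected, then $\operatorname{depth} S/J_G\ge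 f(G)+\operatorname{diam}(G)$. -/

import Mathlib

universe u

noncomputable section

namespace BinomialEdge

/-! ### Graph invariants -/

section Graph

variable {V : Type*}

/-- A vertex is free (or simplicial) if its neighbours induce a complete graph. -/
def IsFreeVertex (G : SimpleGraph V) (v : V) : Prop :=
  G.IsClique (G.neighborSet v)

/-- `f(G)`: the number of free vertices. -/
def numFree (G : SimpleGraph V) : ℕ :=
  {v : V | IsFreeVertex G v}.ncard

/-- `d(G)`: the number of isolated vertices plus the sum of the diameters of the connected
components (for finite `V`, which makes the sum finite and every component of finite diameter). -/
def diamSum [Finite V] (G : SimpleGraph V) : ℕ :=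
  {v : V | G.IsIsolated v}.ncard + ∑ᶠ C : G.ConnectedComponent, C.toSimpleGraph.diam

/-- `ξ(G) = f(G) + d(G)`. -/
def xi [Finite V] (G : SimpleGraph V) : ℕ :=
  numFree G + diamSum G

end Graph

/-! ### The binomial edge ideal -/

/-- The polynomial ring `K[x_v, y_v : v ∈ V]`: the variable `x_v` is indexed by `Sum.inl v`, the
variable `y_v` by `Sum.inr v`. -/
abbrev PolyRing (K : Type u) [Field K] (V : Type) : Type u :=
  MvPolynomial (V ⊕ V) K

section Ideals

variable (K : Type u) [Field K] {V : Type}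

/-- The variable `x_v`. -/
def x (v : V) : PolyRing K V := MvPolynomial.X (Sum.inl v)

/-- The variable `y_v`. -/
def y (v : V) : PolyRing K V := MvPolynomial.X (Sum.inr v)

/-- The binomial edge ideal `J_G`, generated by `x_i y_j - x_j y_i` for the edges `{i, j}` of `G`.
An edge contributes both of its orientations, which differ by a sign, so that no order on `V` is
needed. -/
def binomialEdgeIdeal (G : SimpleGraph V) : Ideal (PolyRing K V) :=
  Ideal.span {p | ∃ i j : V, G.Adj i j ∧ p = x K i * y K j - x K j * y K i}

variable (V) in
/-- The maximal homogeneous ideal, generated by all the variables. -/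
def homogeneousMaximalIdeal : Ideal (PolyRing K V) :=
  Ideal.span (Set.range (x K) ∪ Set.range (y K))

end Ideals

/-! ### Depth -/

/-- The depth of a module `M` with respect to an ideal `I`: the least `i` for which the local
cohomology module `H^i_I(M)` does not vanish (`⊤` if there is none). -/
def depth {R : Type u} [CommRing R] (I : Ideal R) (M : Type u) [AddCommGroup M] [Module R M] :
    ℕ∞ :=
  ⨅ (i : ℕ) (_ : ¬ CategoryTheory.Limits.IsZero ((localCohomology I i).obj (ModuleCat.of R M))), (i : ℕ∞)

/-- `depth S/J_G`, with respect to the maximal homogeneous ideal of the polynomial ring `S`. -/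
def depthQuotient (K : Type u) [Field K] {V : Type} (G : SimpleGraph V) : ℕ∞ :=
  depth (homogeneousMaximalIdeal K V) (PolyRing K V ⧸ binomialEdgeIdeal K G)

end BinomialEdge

end

noncomputable section

namespace BinomialEdge

/-! ### Vanishing of Ext modules and depth -/

section Depth

open CategoryTheory Limits Abelian

variable {R : Type u} [CommRing R]

/-! Local cohomology is a colimit of Ext modules out of the quotients by powers of the ideal, so
depth is bounded below by vanishing of Ext. The predicate `ExtVanish` passes along short exact
sequences and regular elements, which gives the depth lemmas `ExtVanish.quotient_inf` and
`ExtVanish.quotient_regular`.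

For a non-free vertex v let G_v be G with the neighbourhood of v made complete. Then J_G is the
intersection of J_{G_v} and (x_v, y_v) + J_{G-v}, and these two ideals add up to (x_v, y_v) +
J_{G_v-v} (`graphIdeal_eq_inf`, `graphIdeal_sup`). The three graphs have fewer non-free vertices
than G, so induction and the depth lemma give the bound once ξ(G_v) ≥ ξ(G), ξ(G-v) ≥ ξ(G) and
ξ(G_v-v) ≥ ξ(G) - 1. That some v satisfies all three is `exists_vertex_xi_le`. The first and third
are easy for v outside a diametral pair of its component, since completing shortens distances by at
most one. The second is the combinatorial core, `exists_xi_add_two_le`, found by inspecting the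
first vertices of a geodesic between a diametral pair.

The induction ends when all vertices are free. Then G is a disjoint union of cliques, J_G is a toric
prime, and the depth is at least the number of vertices plus the number of components
(`extVanish_clusterIdeal`). This is at least ξ(G), because a clique component adds at most one to
d(G).

Deleted vertices stay in the vertex type as isolated vertices outside a set W. Each of them adds
exactly 2 to ξ, so ξ(G-v) ≥ ξ(G) appears as `xi G + 2 ≤ xi (isolate G v)`. -/

lemma isZero_ext_of_subsingleton (N M : ModuleCat.{u} R) (n : ℕ)
    (h : Subsingleton (Abelian.Ext N M n)) :
    IsZero (((_root_.Ext R (ModuleCat.{u} R) n).obj (Opposite.op N)).obj M) := by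
  -- A single resolution computes both versions of Ext. In positive degree a cocycle represents a
  -- class that vanishes exactly when it is a coboundary. In degree 0 it factors through a map out
  -- of N.
  let P : ProjectiveResolution N := Classical.choice (HasProjectiveResolution.out)
  refine IsZero.of_iso ?_ (P.isoExt n M)
  rw [← HomologicalComplex.exactAt_iff_isZero_homology]
  rcases n with _ | n
  · rw [HomologicalComplex.exactAt_iff' _ 0 0 1 (by simp) (by simp),
      ShortComplex.moduleCat_exact_iff]
    intro (f : P.complex.X 0 ⟶ M) hf
    have hf' : P.complex.d 1 0 ≫ f = 0 := hf
    refine ⟨0, ?_⟩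
    have h0 : f = 0 := by
      have := Ext.homEquiv₀.symm.subsingleton (α := N ⟶ M)
      have h1 : P.exact₀.desc f hf' = (0 : N ⟶ M) := Subsingleton.elim (α := N ⟶ M) _ _
      rw [← P.exact₀.g_desc f hf', h1]
      exact comp_zero
    rw [h0]; exact map_zero _
  · rw [HomologicalComplex.exactAt_iff' _ n (n + 1) (n + 2) (by simp) (by simp),
      ShortComplex.moduleCat_exact_iff]
    intro (f : P.complex.X (n + 1) ⟶ M) hf
    have hf' : P.complex.d (n + 2) (n + 1) ≫ f = 0 := hf
    exact (P.extMk_eq_zero_iff f (n + 2) rfl hf' n rfl).1 (Subsingleton.elim _ _)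

/-- `Ext^i(N, M)` vanishes for all `i < k` and all modules `N` killed by a power of `I`. -/
def ExtVanish (I : Ideal R) (k : ℕ) (M : Type u) [AddCommGroup M] [Module R M] : Prop :=
  ∀ N : ModuleCat.{u} R, (∃ t, I ^ t ≤ Module.annihilator R N) → ∀ i < k,
    Subsingleton (Abelian.Ext N (ModuleCat.of R M) i)

variable {I : Ideal R}

/-- Every term Ext^i(R/I^t, M) of the colimit vanishes, since R/I^t is killed by a power of I. -/
lemma isZero_localCohomology {k : ℕ} {M : Type u} [AddCommGroup M] [Module R M]
    (h : ExtVanish I k M) {i : ℕ} (hi : i < k) :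
    IsZero ((localCohomology I i).obj (ModuleCat.of R M)) := by
  let F := localCohomology.diagram (localCohomology.idealPowersDiagram I) i
  have := localCohomology.hasColimitDiagram (localCohomology.idealPowersDiagram I) i
  change IsZero ((colimit F).obj (ModuleCat.of R M))
  have hc := isColimitOfPreserves ((evaluation _ _).obj (ModuleCat.of R M)) (colimit.isColimit F)
  rw [IsZero.iff_id_eq_zero]
  refine hc.hom_ext fun j => ?_
  have hz : IsZero ((F ⋙ (evaluation _ _).obj (ModuleCat.of R M)).obj j) := by
    refine isZero_ext_of_subsingleton _ _ _ (h _ ⟨j.unop.unop, ?_⟩ i hi)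
    exact (Ideal.annihilator_quotient (I := I ^ j.unop.unop)).ge
  exact hz.eq_of_src _ _

lemma le_depth_of_extVanish {k : ℕ} {M : Type u} [AddCommGroup M] [Module R M]
    (h : ExtVanish I k M) : (k : ℕ∞) ≤ depth I M := by
  refine le_iInf₂ fun i hi => ?_
  by_contra! hlt
  exact hi (isZero_localCohomology h (by exact_mod_cast hlt))

lemma extVanish_zero (I : Ideal R) (M : Type u) [AddCommGroup M] [Module R M] :
    ExtVanish I 0 M := fun _ _ _ hi => absurd hi (Nat.not_lt_zero _)

lemma ExtVanish.mono {k l : ℕ} {M : Type u} [AddCommGroup M] [Module R M]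
    (h : ExtVanish I k M) (hl : l ≤ k) : ExtVanish I l M :=
  fun N hN i hi => h N hN i (hi.trans_le hl)

section Exact

variable {A B C : Type u} [AddCommGroup A] [Module R A] [AddCommGroup B] [Module R B]
  [AddCommGroup C] [Module R C] {f : A →ₗ[R] B} {g : B →ₗ[R] C}

/-- The short complex of modules given by an exact pair of linear maps. -/
abbrev exactComplex (hfg : Function.Exact f g) : ShortComplex (ModuleCat.{u} R) :=
  ShortComplex.mk (ModuleCat.ofHom f) (ModuleCat.ofHom g) (by
    rw [← ModuleCat.ofHom_comp, hfg.linearMap_comp_eq_zero]; rfl)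

lemma exactComplex_shortExact (hf : Function.Injective f) (hfg : Function.Exact f g)
    (hg : Function.Surjective g) : (exactComplex hfg).ShortExact :=
  ModuleCat.shortComplex_shortExact _ hfg hf hg

lemma ExtVanish.of_exact_middle (hf : Function.Injective f) (hfg : Function.Exact f g)
    (hg : Function.Surjective g) {k : ℕ} (hA : ExtVanish I k A) (hC : ExtVanish I k C) :
    ExtVanish I k B := by
  intro N hN i hi
  have hS := exactComplex_shortExact hf hfg hg
  have h1 : Subsingleton (Abelian.Ext N (exactComplex hfg).X₁ i) := hA N hN i hi
  have h3 : Subsingleton (Abelian.Ext N (exactComplex hfg).X₃ i) := hC N hN i hi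
  refine subsingleton_of_forall_eq 0 fun e => ?_
  obtain ⟨e', rfl⟩ := Ext.covariant_sequence_exact₂ N hS e (Subsingleton.elim _ _)
  rw [Subsingleton.elim e' 0, Ext.zero_comp]

lemma ExtVanish.of_exact_left (hf : Function.Injective f) (hfg : Function.Exact f g)
    (hg : Function.Surjective g) {k : ℕ} (hB : ExtVanish I (k + 1) B) (hC : ExtVanish I k C) :
    ExtVanish I (k + 1) A := by
  intro N hN i hi
  have hS := exactComplex_shortExact hf hfg hg
  have h2 : Subsingleton (Abelian.Ext N (exactComplex hfg).X₂ i) := hB N hN i hi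
  refine subsingleton_of_forall_eq 0 fun e => ?_
  rcases i with _ | i
  · have : Mono (exactComplex hfg).f := hS.mono_f
    exact Ext.postcomp_mk₀_injective_of_mono N (exactComplex hfg).f (Subsingleton.elim _ _)
  · have h3 : Subsingleton (Abelian.Ext N (exactComplex hfg).X₃ i) := hC N hN i (by omega)
    obtain ⟨e', rfl⟩ := Ext.covariant_sequence_exact₁ N hS e (Subsingleton.elim _ _)
      (rfl : i + 1 = i + 1)
    rw [Subsingleton.elim e' 0, Ext.zero_comp]

end Exact

/-- On Ext^i(N, M) multiplication by z is injective, by the long exact sequence and the vanishing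
one degree lower for Q = M/zM. It is also nilpotent, because some power of z kills N. Hence the
module is zero. -/
lemma ExtVanish.of_smul_regular {M Q : Type u} [AddCommGroup M] [Module R M]
    [AddCommGroup Q] [Module R Q] {z : R} (hz : z ∈ I) {g : M →ₗ[R] Q}
    (hzM : IsSMulRegular M z)
    (hfg : Function.Exact (LinearMap.lsmul R M z) g) (hg : Function.Surjective g)
    {k : ℕ} (hQ : ExtVanish I k Q) : ExtVanish I (k + 1) M := by
  intro N ⟨t, ht⟩ i hi
  have hS := exactComplex_shortExact (f := LinearMap.lsmul R M z) hzM hfg hg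
  have hinj : IsSMulRegular (Abelian.Ext N (ModuleCat.of R M) i) z := by
    rw [← Ext.postcomp_smul_id_mono_iff, AddCommGrpCat.mono_iff_injective]
    rw [injective_iff_map_eq_zero]
    intro e he
    rcases i with _ | i
    · have : Mono (exactComplex hfg).f := hS.mono_f
      exact Ext.postcomp_mk₀_injective_of_mono N (exactComplex hfg).f (he.trans (map_zero _).symm)
    · have h3 : Subsingleton (Abelian.Ext N (exactComplex hfg).X₃ i) := hQ N ⟨t, ht⟩ i (by omega)
      obtain ⟨e', rfl⟩ := Ext.covariant_sequence_exact₁ N hS e he (rfl : i + 1 = i + 1)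
      rw [Subsingleton.elim e' 0, Ext.zero_comp]
  refine subsingleton_of_forall_eq 0 fun e => (hinj.pow t) ?_
  have h0 := Ext.postcomp_smul_id_eq_zero_of_mem_annihilator (M := ModuleCat.of R M)
    (ht (Ideal.pow_mem_pow hz t)) i
  have h1 : ((Ext.mk₀ (z ^ t • 𝟙 (ModuleCat.of R M))).postcomp N (add_zero i)) e = 0 :=
    DFunLike.congr_fun (congrArg AddCommGrpCat.Hom.hom h0) e
  simp only [Ext.mk₀_smul] at h1
  simpa using h1

/-- Depth lemma for a quotient by an intersection of two ideals. -/
lemma ExtVanish.quotient_inf {J A B : Ideal R} (hJ : J = A ⊓ B) {k : ℕ}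
    (hA : ExtVanish I (k + 1) (R ⧸ A)) (hB : ExtVanish I (k + 1) (R ⧸ B))
    (hAB : ExtVanish I k (R ⧸ A ⊔ B)) : ExtVanish I (k + 1) (R ⧸ J) := by
  subst hJ
  have hprod : ExtVanish I (k + 1) ((R ⧸ A) × (R ⧸ B)) :=
    ExtVanish.of_exact_middle (f := LinearMap.inl R (R ⧸ A) (R ⧸ B))
      (g := LinearMap.snd R (R ⧸ A) (R ⧸ B)) LinearMap.inl_injective Function.Exact.inl_snd
      LinearMap.snd_surjective hA hB
  -- The Mayer–Vietoris sequence 0 → R/(A ∩ B) → R/A × R/B → R/(A + B) → 0, whose second map is the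
  -- difference.
  let f : (R ⧸ A ⊓ B) →ₗ[R] (R ⧸ A) × (R ⧸ B) :=
    (Submodule.factor (p := A ⊓ B) (p' := A) inf_le_left).prod
      (Submodule.factor (p := A ⊓ B) (p' := B) inf_le_right)
  let g : (R ⧸ A) × (R ⧸ B) →ₗ[R] (R ⧸ A ⊔ B) :=
    (Submodule.factor (p := A) (p' := A ⊔ B) le_sup_left).coprod
      (-(Submodule.factor (p := B) (p' := A ⊔ B) le_sup_right))
  refine ExtVanish.of_exact_left (f := f) (g := g) ?_ ?_ ?_ hprod hAB
  · rw [injective_iff_map_eq_zero]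
    intro a ha
    obtain ⟨a, rfl⟩ := Submodule.mkQ_surjective _ a
    have h1 : (Submodule.Quotient.mk a : R ⧸ A) = 0 := congrArg Prod.fst ha
    have h2 : (Submodule.Quotient.mk a : R ⧸ B) = 0 := congrArg Prod.snd ha
    rw [Submodule.Quotient.mk_eq_zero] at h1 h2
    exact (Submodule.Quotient.mk_eq_zero _).2 ⟨h1, h2⟩
  · rintro ⟨a, b⟩
    obtain ⟨a, rfl⟩ := Submodule.mkQ_surjective _ a
    obtain ⟨b, rfl⟩ := Submodule.mkQ_surjective _ b
    have hg : g (A.mkQ a, B.mkQ b) = (Submodule.Quotient.mk (a - b) : R ⧸ A ⊔ B) := by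
      rw [Submodule.Quotient.mk_sub, sub_eq_add_neg]; rfl
    rw [hg, Submodule.Quotient.mk_eq_zero]
    constructor
    · intro hab
      obtain ⟨x, hx, y, hy, hxy⟩ := Submodule.mem_sup.1 hab
      refine ⟨Submodule.Quotient.mk (a - x), Prod.ext ?_ ?_⟩
      · exact (Submodule.Quotient.eq A).2 (by simpa using hx)
      · refine (Submodule.Quotient.eq B).2 ?_
        change a - x - b ∈ B
        rwa [show a - x - b = y by rw [sub_right_comm, ← hxy]; ring]
    · rintro ⟨c, hc⟩
      obtain ⟨c, rfl⟩ := Submodule.mkQ_surjective _ c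
      have h1 : c - a ∈ A := (Submodule.Quotient.eq A).1 (congrArg Prod.fst hc)
      have h2 : c - b ∈ B := (Submodule.Quotient.eq B).1 (congrArg Prod.snd hc)
      rw [show a - b = -(c - a) + (c - b) by ring]
      exact add_mem (Submodule.mem_sup_left (neg_mem h1)) (Submodule.mem_sup_right h2)
  · intro c
    obtain ⟨c, rfl⟩ := Submodule.mkQ_surjective _ c
    refine ⟨(A.mkQ c, 0), ?_⟩
    simp only [g, LinearMap.coprod_apply, map_zero, add_zero]
    rfl

/-- Depth lemma for a quotient by an ideal and a regular element. -/
lemma ExtVanish.quotient_regular {J L : Ideal R} {z : R} (hz : z ∈ I)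
    (hreg : ∀ a, z * a ∈ J → a ∈ J) (hL : L = J ⊔ Ideal.span {z}) {k : ℕ}
    (h : ExtVanish I k (R ⧸ L)) : ExtVanish I (k + 1) (R ⧸ J) := by
  subst hL
  refine ExtVanish.of_smul_regular hz
    (g := Submodule.factor (p := J) (p' := J ⊔ Ideal.span {z}) le_sup_left) ?_ ?_ ?_ h
  · rw [isSMulRegular_iff_right_eq_zero_of_smul]
    intro a ha
    obtain ⟨a, rfl⟩ := Submodule.mkQ_surjective _ a
    rw [← map_smul, Submodule.mkQ_apply, Submodule.Quotient.mk_eq_zero] at ha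
    exact (Submodule.Quotient.mk_eq_zero _).2 (hreg a ha)
  · intro a
    obtain ⟨a, rfl⟩ := Submodule.mkQ_surjective _ a
    change (Submodule.Quotient.mk a : R ⧸ J ⊔ Ideal.span {z}) = 0 ↔ _
    rw [Submodule.Quotient.mk_eq_zero]
    constructor
    · intro ha
      obtain ⟨x, hx, y, hy, hxy⟩ := Submodule.mem_sup.1 ha
      obtain ⟨c, rfl⟩ := Ideal.mem_span_singleton'.1 hy
      refine ⟨Submodule.Quotient.mk c, ?_⟩
      refine (Submodule.Quotient.eq J).2 ?_
      change z * c - a ∈ J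
      rw [← hxy, show z * c - (x + c * z) = -x by ring]
      exact neg_mem hx
    · rintro ⟨c, hc⟩
      obtain ⟨c, rfl⟩ := Submodule.mkQ_surjective _ c
      have h1 : z * c - a ∈ J := (Submodule.Quotient.eq J).1 hc
      rw [show a = -(z * c - a) + c * z by ring]
      exact add_mem (Submodule.mem_sup_left (neg_mem h1))
        (Submodule.mem_sup_right (Ideal.mem_span_singleton'.2 ⟨c, rfl⟩))
  · exact Submodule.factor_surjective _

end Depth

/-! ### Ideals of cluster graphs -/

section Cluster

open MvPolynomial

variable (K : Type u) [Field K] {V : Type} {ι : Type}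

/-- The vertex of a variable. -/
def vertexOf : V ⊕ V → V := Sum.elim id id

@[simp] lemma vertexOf_inl (v : V) : vertexOf (Sum.inl v : V ⊕ V) = v := rfl
@[simp] lemma vertexOf_inr (v : V) : vertexOf (Sum.inr v : V ⊕ V) = v := rfl

/-- The ideal generated by the variables in `Z` and the binomials of all pairs of vertices of `W`
with the same label under `c`. -/
def clusterIdeal (Z : Finset (V ⊕ V)) (W : Finset V) (c : V → ι) : Ideal (PolyRing K V) :=
  Ideal.span {p | (∃ s ∈ Z, p = X s) ∨
    ∃ i ∈ W, ∃ j ∈ W, c i = c j ∧ p = x K i * y K j - x K j * y K i}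

variable {K} {Z : Finset (V ⊕ V)} {W : Finset V} {c : V → ι}

lemma X_mem_clusterIdeal {s : V ⊕ V} (hs : s ∈ Z) : (X s : PolyRing K V) ∈ clusterIdeal K Z W c :=
  Ideal.subset_span (Or.inl ⟨s, hs, rfl⟩)

lemma binomial_mem_clusterIdeal {i j : V} (hi : i ∈ W) (hj : j ∈ W) (hc : c i = c j) :
    x K i * y K j - x K j * y K i ∈ clusterIdeal K Z W c :=
  Ideal.subset_span (Or.inr ⟨i, hi, j, hj, hc, rfl⟩)

lemma clusterIdeal_le {L : Ideal (PolyRing K V)} (hZ : ∀ s ∈ Z, (X s : PolyRing K V) ∈ L)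
    (hW : ∀ i ∈ W, ∀ j ∈ W, c i = c j → x K i * y K j - x K j * y K i ∈ L) :
    clusterIdeal K Z W c ≤ L := by
  refine Ideal.span_le.2 ?_
  rintro p (⟨s, hs, rfl⟩ | ⟨i, hi, j, hj, hc, rfl⟩)
  · exact hZ s hs
  · exact hW i hi j hj hc

lemma monomial_mem_clusterIdeal {s : V ⊕ V} (hs : s ∈ Z) {e : V ⊕ V →₀ ℕ} (he : e s ≠ 0) :
    (monomial e 1 : PolyRing K V) ∈ clusterIdeal K Z W c := by
  classical
  have h : (monomial e 1 : PolyRing K V) = monomial (e - Finsupp.single s 1) 1 * X s := by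
    rw [X, monomial_mul, mul_one, tsub_add_cancel_of_le]
    simpa using Nat.one_le_iff_ne_zero.2 he
  rw [h]
  exact Ideal.mul_mem_left _ _ (X_mem_clusterIdeal hs)

variable [DecidableEq V] [DecidableEq ι]

set_option linter.unusedSectionVars false

/-- The hypotheses say that both monomials have the same image under the parametrization below. If
they differ, some b has too large a y-exponent and some d with the same label too small a one.
Replacing x_d y_b by x_b y_d changes the monomial by an element of the ideal and lowers the total
y-excess, on which the induction runs. -/
lemma monomial_sub_monomial_mem_clusterIdeal {e e' : V ⊕ V →₀ ℕ}
    (hfree : ∀ s, vertexOf s ∉ W → e s = e' s)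
    (hvert : ∀ b ∈ W, e (Sum.inl b) + e (Sum.inr b) = e' (Sum.inl b) + e' (Sum.inr b))
    (hlab : ∀ C, ∑ b ∈ W with c b = C, e (Sum.inr b) = ∑ b ∈ W with c b = C, e' (Sum.inr b)) :
    (monomial e 1 - monomial e' 1 : PolyRing K V) ∈ clusterIdeal K Z W c := by
  induction hn : ∑ b ∈ W, (e (Sum.inr b) - e' (Sum.inr b)) using Nat.strong_induction_on
    generalizing e with
  | _ n ih =>
  by_cases hle : ∀ b ∈ W, e (Sum.inr b) ≤ e' (Sum.inr b)
  · have hr : ∀ b ∈ W, e (Sum.inr b) = e' (Sum.inr b) := fun b hb =>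
      (Finset.sum_eq_sum_iff_of_le (fun i hi => hle i (Finset.mem_filter.1 hi).1)).1 (hlab (c b)) b
        (Finset.mem_filter.2 ⟨hb, rfl⟩)
    have : e = e' := by
      ext s
      by_cases hs : vertexOf s ∈ W
      · rcases s with b | b
        · have h1 := hvert b hs
          have h2 := hr b hs
          omega
        · exact hr b hs
      · exact hfree s hs
    rw [this, sub_self]
    exact zero_mem _
  · push Not at hle
    obtain ⟨b, hb, hlt⟩ := hle
    obtain ⟨d, hd, hdlt⟩ : ∃ d ∈ W.filter (c · = c b), e (Sum.inr d) < e' (Sum.inr d) := by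
      by_contra! hcon
      exact absurd (hlab (c b)) (Finset.sum_lt_sum hcon ⟨b, by simp [hb], hlt⟩).ne'
    obtain ⟨hdW, hdc⟩ := Finset.mem_filter.1 hd
    have hbd : b ≠ d := by rintro rfl; omega
    have hdv := hvert d hdW
    let e₀ : V ⊕ V →₀ ℕ := e - (Finsupp.single (Sum.inr b) 1 + Finsupp.single (Sum.inl d) 1)
    have he : e = e₀ + (Finsupp.single (Sum.inr b) 1 + Finsupp.single (Sum.inl d) 1) := by
      refine (tsub_add_cancel_of_le fun s => ?_).symm
      rcases s with s | s
      · by_cases h : d = s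
        · subst h; simp; omega
        · simp [h]
      · by_cases h : b = s
        · subst h; simp; omega
        · simp [h]
    let e₁ : V ⊕ V →₀ ℕ := e₀ + (Finsupp.single (Sum.inl b) 1 + Finsupp.single (Sum.inr d) 1)
    have hdiff : (monomial e 1 - monomial e₁ 1 : PolyRing K V) ∈ clusterIdeal K Z W c := by
      have : (monomial e 1 - monomial e₁ 1 : PolyRing K V) =
          monomial e₀ 1 * (x K d * y K b - x K b * y K d) := by
        rw [he]
        simp only [e₁, x, y, X, mul_sub, monomial_mul, mul_one]
        rw [add_comm (Finsupp.single (Sum.inr b) 1)]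
      rw [this]
      exact Ideal.mul_mem_left _ _ (binomial_mem_clusterIdeal hdW hb hdc)
    have hr : ∀ a, e₁ (Sum.inr a) + (if a = b then 1 else 0) =
        e (Sum.inr a) + (if a = d then 1 else 0) := by
      intro a
      rw [he]
      simp only [e₁, Finsupp.add_apply, Finsupp.single_apply, reduceCtorEq, Sum.inr.injEq, if_false,
        eq_comm (a := b), eq_comm (a := d)]
      omega
    have hl : ∀ a, e₁ (Sum.inl a) + (if a = d then 1 else 0) =
        e (Sum.inl a) + (if a = b then 1 else 0) := by
      intro a
      rw [he]
      simp only [e₁, Finsupp.add_apply, Finsupp.single_apply, reduceCtorEq, Sum.inl.injEq, if_false,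
        eq_comm (a := b), eq_comm (a := d)]
      omega
    have hmem := ih (∑ b ∈ W, (e₁ (Sum.inr b) - e' (Sum.inr b))) ?_ (e := e₁) ?_ ?_ ?_ rfl
    · rw [← sub_add_sub_cancel _ (monomial e₁ 1 : PolyRing K V)]
      exact add_mem hdiff hmem
    · rw [← hn]
      refine Finset.sum_lt_sum (fun a _ => ?_) ⟨b, hb, ?_⟩
      · have := hr a
        by_cases hab : a = b
        · subst hab; simp [hbd] at this; omega
        · by_cases had : a = d
          · subst had; simp [hab] at this; omega
          · simp [hab, had] at this; omega
      · have := hr b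
        simp [hbd] at this; omega
    · intro s hs
      rw [← hfree s hs]
      have hsb : vertexOf s ≠ b := fun h => hs (h ▸ hb)
      have hsd : vertexOf s ≠ d := fun h => hs (h ▸ hdW)
      rcases s with s | s
      · simpa [show s ≠ b from hsb, show s ≠ d from hsd] using hl s
      · simpa [show s ≠ b from hsb, show s ≠ d from hsd] using hr s
    · intro a ha
      have h1 := hvert a ha
      have h2 := hr a
      have h3 := hl a
      omega
    · intro C
      rw [← hlab C]
      have h1 : ∑ a ∈ W with c a = C, (e₁ (Sum.inr a) + (if a = b then 1 else 0)) =
          ∑ a ∈ W with c a = C, (e (Sum.inr a) + (if a = d then 1 else 0)) :=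
        Finset.sum_congr rfl fun a _ => hr a
      rw [Finset.sum_add_distrib, Finset.sum_add_distrib, Finset.sum_ite_eq',
        Finset.sum_ite_eq'] at h1
      have h2 : (b ∈ W.filter (c · = C)) ↔ (d ∈ W.filter (c · = C)) := by
        simp [hb, hdW, hdc]
      simp only [h2] at h1
      omega

variable (Z W c)

/-- The image of a variable under the parametrization of the variety of a cluster ideal. -/
def paramVar (s : V ⊕ V) : (V ⊕ V) ⊕ (ι ⊕ ι) →₀ ℕ :=
  if vertexOf s ∈ W then Finsupp.single (Sum.inl (Sum.inl (vertexOf s))) 1 +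
    Finsupp.single (Sum.inr (s.map c c)) 1
  else Finsupp.single (Sum.inl s) 1

variable (K) in
/-- The parametrization of the variety of a cluster ideal. -/
def param : PolyRing K V →ₐ[K] MvPolynomial ((V ⊕ V) ⊕ (ι ⊕ ι)) K :=
  aeval fun s => if s ∈ Z then 0 else monomial (paramVar W c s) 1

/-- The exponent vector of the image of a monomial under `param`. -/
def paramExp (e : V ⊕ V →₀ ℕ) : (V ⊕ V) ⊕ (ι ⊕ ι) →₀ ℕ :=
  e.sum fun s n => n • paramVar W c s

variable {Z W c}

lemma param_monomial {e : V ⊕ V →₀ ℕ} (he : ∀ s ∈ Z, e s = 0) :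
    param K Z W c (monomial e 1) = monomial (paramExp W c e) 1 := by
  rw [param, aeval_monomial, map_one, one_mul, paramExp, Finsupp.sum, monomial_sum_one,
    Finsupp.prod]
  refine Finset.prod_congr rfl fun s hs => ?_
  rw [if_neg fun h => Finsupp.mem_support_iff.1 hs (he s h), monomial_pow, one_pow]

lemma paramExp_apply [Fintype V] (e : V ⊕ V →₀ ℕ) (t : (V ⊕ V) ⊕ (ι ⊕ ι)) :
    paramExp W c e t = ∑ s, e s * paramVar W c s t := by
  rw [paramExp, Finsupp.sum_fintype _ _ (by simp), Finsupp.finsetSum_apply]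
  rfl

lemma paramExp_inl [Fintype V] (e : V ⊕ V →₀ ℕ) {s : V ⊕ V} (hs : vertexOf s ∉ W) :
    paramExp W c e (Sum.inl s) = e s := by
  rw [paramExp_apply, Finset.sum_eq_single s]
  · simp [paramVar, hs]
  · intro t _ hts
    rw [paramVar]
    split_ifs with ht
    · have : Sum.inl (vertexOf t) ≠ s := by rintro rfl; exact hs ht
      simp [this]
    · simp [hts]
  · simp

lemma paramExp_inl_inl [Fintype V] (e : V ⊕ V →₀ ℕ) {b : V} (hb : b ∈ W) :
    paramExp W c e (Sum.inl (Sum.inl b)) = e (Sum.inl b) + e (Sum.inr b) := by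
  rw [paramExp_apply, Fintype.sum_sum_type, Finset.sum_eq_single b, Finset.sum_eq_single b]
  · simp [paramVar, hb]
  · intro a _ hab
    rw [paramVar]
    split_ifs <;> simp [hab]
  · simp
  · intro a _ hab
    rw [paramVar]
    split_ifs <;> simp [hab]
  · simp

lemma paramExp_inr_inr [Fintype V] (e : V ⊕ V →₀ ℕ) (C : ι) :
    paramExp W c e (Sum.inr (Sum.inr C)) = ∑ b ∈ W with c b = C, e (Sum.inr b) := by
  rw [paramExp_apply, Fintype.sum_sum_type, Finset.sum_filter,
    ← Finset.sum_filter_add_sum_filter_not Finset.univ (· ∈ W)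
      (fun b : V => e (Sum.inr b) * paramVar W c (Sum.inr b) (Sum.inr (Sum.inr C)))]
  have h1 : ∑ b : V, e (Sum.inl b) * paramVar W c (Sum.inl b) (Sum.inr (Sum.inr C)) = 0 := by
    refine Finset.sum_eq_zero fun b _ => ?_
    rw [paramVar]
    split_ifs <;> simp
  have h2 : ∑ b : V with b ∉ W,
      e (Sum.inr b) * paramVar W c (Sum.inr b) (Sum.inr (Sum.inr C)) = 0 := by
    refine Finset.sum_eq_zero fun b hb => ?_
    simp [paramVar, (Finset.mem_filter.1 hb).2]
  rw [h1, h2, zero_add, add_zero, Finset.filter_mem_eq_inter, Finset.univ_inter]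
  refine Finset.sum_congr rfl fun b hb => ?_
  simp [paramVar, hb, Finsupp.single_apply]

/-- The parametrization is x_b ↦ a_b s_{c(b)}, y_b ↦ a_b t_{c(b)} on W, so the ideal is prime. This
is what makes variables outside Z regular on the quotient. -/
theorem clusterIdeal_eq_ker [Fintype V] (hZW : ∀ s ∈ Z, vertexOf s ∉ W) :
    clusterIdeal K Z W c = RingHom.ker (param K Z W c) := by
  classical
  apply le_antisymm
  · refine clusterIdeal_le (fun s hs => ?_) (fun i hi j hj hc => ?_)
    · simp [RingHom.mem_ker, param, hs]
    · have hZ : ∀ s, vertexOf s ∈ W → s ∉ Z := fun s hs h => hZW s h hs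
      rw [RingHom.mem_ker, map_sub, map_mul, map_mul, sub_eq_zero]
      simp only [param, x, y, aeval_X, if_neg (hZ (Sum.inl i) hi), if_neg (hZ (Sum.inl j) hj),
        if_neg (hZ (Sum.inr i) hi), if_neg (hZ (Sum.inr j) hj), monomial_mul, paramVar,
        vertexOf_inl, vertexOf_inr, hi, hj, if_true, Sum.map_inl, Sum.map_inr, hc]
      rw [add_add_add_comm, add_comm (Finsupp.single (Sum.inl (Sum.inl i)) 1), ← add_add_add_comm]
  -- A linear map undoing `param` modulo the ideal: it sends a monomial in the image to a chosen
  -- preimage. Independence of the choice modulo the ideal is the preceding swapping argument.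
  · let θ : MvPolynomial ((V ⊕ V) ⊕ (ι ⊕ ι)) K →ₗ[K] (PolyRing K V ⧸ clusterIdeal K Z W c) :=
      (basisMonomials _ K).constr K fun m =>
        if h : ∃ e : V ⊕ V →₀ ℕ, (∀ s ∈ Z, e s = 0) ∧ paramExp W c e = m then
          Ideal.Quotient.mk _ (monomial h.choose 1) else 0
    have hθ : θ ∘ₗ (param K Z W c).toLinearMap =
        (Ideal.Quotient.mkₐ K (clusterIdeal K Z W c)).toLinearMap := by
      refine (basisMonomials _ K).ext fun e => ?_
      rw [coe_basisMonomials]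
      by_cases he : ∀ s ∈ Z, e s = 0
      · have hex : ∃ e' : V ⊕ V →₀ ℕ, (∀ s ∈ Z, e' s = 0) ∧ paramExp W c e' = paramExp W c e :=
          ⟨e, he, rfl⟩
        have h1 : θ (monomial (paramExp W c e) 1) =
            Ideal.Quotient.mk _ (monomial hex.choose 1) := by
          have := (basisMonomials ((V ⊕ V) ⊕ (ι ⊕ ι)) K).constr_basis K (fun m =>
            if h : ∃ e : V ⊕ V →₀ ℕ, (∀ s ∈ Z, e s = 0) ∧ paramExp W c e = m then
              Ideal.Quotient.mk (clusterIdeal K Z W c) (monomial h.choose 1) else 0)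
              (paramExp W c e)
          rw [coe_basisMonomials, dif_pos hex] at this
          exact this
        rw [LinearMap.comp_apply, AlgHom.toLinearMap_apply, param_monomial he, h1]
        refine Ideal.Quotient.eq.2 (monomial_sub_monomial_mem_clusterIdeal ?_ ?_ ?_)
        · intro s hs
          rw [← paramExp_inl (c := c) _ hs, hex.choose_spec.2, paramExp_inl _ hs]
        · intro b hb
          rw [← paramExp_inl_inl (c := c) _ hb, hex.choose_spec.2, paramExp_inl_inl _ hb]
        · intro C
          rw [← paramExp_inr_inr, hex.choose_spec.2, paramExp_inr_inr]
      · push Not at he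
        obtain ⟨s, hs, hes⟩ := he
        have hm := monomial_mem_clusterIdeal (K := K) (W := W) (c := c) hs hes
        have h0 : param K Z W c (monomial e 1) = 0 := by
          rw [param, aeval_monomial, Finsupp.prod, Finset.prod_eq_zero
            (Finsupp.mem_support_iff.2 hes) (by rw [if_pos hs, zero_pow hes]), mul_zero]
        rw [LinearMap.comp_apply, AlgHom.toLinearMap_apply, h0, map_zero]
        exact (Ideal.Quotient.eq_zero_iff_mem.2 hm).symm
    intro f hf
    have h := LinearMap.congr_fun hθ f
    rw [LinearMap.comp_apply, AlgHom.toLinearMap_apply, RingHom.mem_ker.1 hf, map_zero] at h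
    exact Ideal.Quotient.eq_zero_iff_mem.1 h.symm

lemma mem_of_X_mul_mem_clusterIdeal [Fintype V] (hZW : ∀ s ∈ Z, vertexOf s ∉ W) {s : V ⊕ V}
    (hs : s ∉ Z) {f : PolyRing K V} (hf : X s * f ∈ clusterIdeal K Z W c) :
    f ∈ clusterIdeal K Z W c := by
  rw [clusterIdeal_eq_ker hZW] at hf ⊢
  have hprime := RingHom.ker_isPrime (param K Z W c)
  refine (hprime.mem_or_mem hf).resolve_left fun h => ?_
  rw [RingHom.mem_ker, param, aeval_X, if_neg hs, monomial_eq_zero] at h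
  exact one_ne_zero h

end Cluster

/-! ### Depth of the quotients by cluster ideals. -/

section ClusterDepth

open MvPolynomial

variable {K : Type u} [Field K] {V : Type} {ι : Type}

lemma X_mem_homogeneousMaximalIdeal (s : V ⊕ V) :
    (X s : PolyRing K V) ∈ homogeneousMaximalIdeal K V := by
  rcases s with v | v
  · exact Ideal.subset_span (Or.inl ⟨v, rfl⟩)
  · exact Ideal.subset_span (Or.inr ⟨v, rfl⟩)

variable [Fintype V] [DecidableEq V] [DecidableEq ι]

/-- The Krull dimension of the quotient by a cluster ideal. -/
def clusterDim (Z : Finset (V ⊕ V)) (W : Finset V) (c : V → ι) : ℕ :=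
  (Finset.univ.filter fun s => s ∉ Z ∧ vertexOf s ∉ W).card + W.card + (W.image c).card

/-- Induction on the number of variables not yet killed. Free variables are regular and are killed
one at a time. Otherwise x_a is killed for some a in W. If a is alone in its cluster, y_a becomes a
free variable. If not, adding x_a gives an intersection of two cluster ideals whose sum is again a
cluster ideal, so the depth lemma applies. -/
theorem extVanish_clusterIdeal (Z : Finset (V ⊕ V)) (W : Finset V) (c : V → ι)
    (hZW : ∀ s ∈ Z, vertexOf s ∉ W) :
    ExtVanish (homogeneousMaximalIdeal K V) (clusterDim Z W c)
      (PolyRing K V ⧸ clusterIdeal K Z W c) := by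
  induction hn : Zᶜ.card using Nat.strong_induction_on generalizing Z W with
  | _ n ih =>
  have hcard : ∀ {Z' : Finset (V ⊕ V)} {s : V ⊕ V}, Z ⊆ Z' → s ∈ Z' → s ∉ Z → Z'ᶜ.card < n := by
    intro Z' s hsub hs' hs
    rw [← hn]
    refine Finset.card_lt_card (Finset.compl_ssubset_compl.2 ⟨hsub, fun h => hs (h hs')⟩)
  by_cases hfree : ∃ s, s ∉ Z ∧ vertexOf s ∉ W
  · obtain ⟨s, hsZ, hsW⟩ := hfree
    have hZW' : ∀ t ∈ insert s Z, vertexOf t ∉ W := by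
      intro t ht
      rcases Finset.mem_insert.1 ht with rfl | ht
      exacts [hsW, hZW t ht]
    have hdim : clusterDim Z W c = clusterDim (insert s Z) W c + 1 := by
      have herase : (Finset.univ.filter fun t => t ∉ insert s Z ∧ vertexOf t ∉ W) =
          (Finset.univ.filter fun t => t ∉ Z ∧ vertexOf t ∉ W).erase s := by
        ext t; simp [and_assoc, not_or]
      have hmem : s ∈ Finset.univ.filter fun t => t ∉ Z ∧ vertexOf t ∉ W := by simp [hsZ, hsW]
      have := Finset.card_pos.2 ⟨s, hmem⟩
      rw [clusterDim, clusterDim, herase, Finset.card_erase_of_mem hmem]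
      omega
    rw [hdim]
    refine ExtVanish.quotient_regular (X_mem_homogeneousMaximalIdeal s)
      (fun f hf => mem_of_X_mul_mem_clusterIdeal hZW hsZ hf) ?_
      (ih _ (hcard (Finset.subset_insert s Z) (Finset.mem_insert_self s Z) hsZ) _ W hZW' rfl)
    apply le_antisymm
    · refine clusterIdeal_le (fun t ht => ?_) fun i hi j hj hc =>
        Ideal.mem_sup_left (binomial_mem_clusterIdeal hi hj hc)
      rcases Finset.mem_insert.1 ht with rfl | ht
      · exact Ideal.mem_sup_right (Ideal.mem_span_singleton_self _)
      · exact Ideal.mem_sup_left (X_mem_clusterIdeal ht)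
    · refine sup_le (clusterIdeal_le (fun t ht => X_mem_clusterIdeal (Finset.mem_insert_of_mem ht))
        fun i hi j hj hc => binomial_mem_clusterIdeal hi hj hc) ?_
      rw [Ideal.span_singleton_le_iff_mem]
      exact X_mem_clusterIdeal (Finset.mem_insert_self s Z)
  push Not at hfree
  have hfree0 : (Finset.univ.filter fun s => s ∉ Z ∧ vertexOf s ∉ W) = ∅ :=
    Finset.filter_eq_empty_iff.2 fun s _ h => h.2 (hfree s h.1)
  rcases W.eq_empty_or_nonempty with rfl | ⟨a, ha⟩
  · rw [clusterDim, hfree0]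
    exact extVanish_zero _ _
  have haZ : Sum.inl a ∉ Z := fun h => hZW _ h ha
  have haZ' : Sum.inr a ∉ Z := fun h => hZW _ h ha
  have hreg := fun f hf => mem_of_X_mul_mem_clusterIdeal (K := K) (c := c) hZW haZ (f := f) hf
  have hdim0 : clusterDim Z W c = W.card + (W.image c).card := by
    rw [clusterDim, hfree0, Finset.card_empty, zero_add]
  have hWpos := Finset.card_pos.2 ⟨a, ha⟩
  by_cases hsingle : ∀ b ∈ W, c b = c a → b = a
  · have hZW' : ∀ t ∈ insert (Sum.inl a) Z, vertexOf t ∉ W.erase a := by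
      intro t ht h
      rcases Finset.mem_insert.1 ht with rfl | ht
      · simp at h
      · exact hZW t ht (Finset.mem_of_mem_erase h)
    have h := ih _ (hcard (Finset.subset_insert _ Z) (Finset.mem_insert_self _ Z) haZ) _
      (W.erase a) hZW' rfl
    have hdim : clusterDim Z W c ≤ clusterDim (insert (Sum.inl a) Z) (W.erase a) c + 1 := by
      have h1 : 0 < (Finset.univ.filter fun s : V ⊕ V =>
          s ∉ insert (Sum.inl a) Z ∧ vertexOf s ∉ W.erase a).card :=
        Finset.card_pos.2 ⟨Sum.inr a, by simp [haZ']⟩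
      have h2 : (W.image c).card ≤ ((W.erase a).image c).card + 1 := by
        rw [← Finset.insert_erase ha, Finset.image_insert]
        exact (Finset.card_insert_le _ _).trans (by simp)
      rw [hdim0, clusterDim, Finset.card_erase_of_mem ha]
      omega
    refine ExtVanish.mono (ExtVanish.quotient_regular
      (X_mem_homogeneousMaximalIdeal _) hreg ?_ h) hdim
    apply le_antisymm
    · refine clusterIdeal_le (fun t ht => ?_) fun i hi j hj hc => Ideal.mem_sup_left
        (binomial_mem_clusterIdeal (Finset.mem_of_mem_erase hi) (Finset.mem_of_mem_erase hj) hc)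
      rcases Finset.mem_insert.1 ht with rfl | ht
      · exact Ideal.mem_sup_right (Ideal.mem_span_singleton_self _)
      · exact Ideal.mem_sup_left (X_mem_clusterIdeal ht)
    · refine sup_le (clusterIdeal_le (fun t ht => X_mem_clusterIdeal (Finset.mem_insert_of_mem ht))
        fun i hi j hj hc => ?_) ?_
      · by_cases hia : i = a
        · rw [hsingle j hj (hc.symm.trans (congrArg c hia)), hia, sub_self]
          exact zero_mem _
        · by_cases hja : j = a
          · exact absurd (hsingle i hi (hc.trans (congrArg c hja))) hia
          · exact binomial_mem_clusterIdeal (Finset.mem_erase.2 ⟨hia, hi⟩)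
              (Finset.mem_erase.2 ⟨hja, hj⟩) hc
      · rw [Ideal.span_singleton_le_iff_mem]
        exact X_mem_clusterIdeal (Finset.mem_insert_self _ Z)
  push Not at hsingle
  obtain ⟨b, hb, hbc, hba⟩ := hsingle
  -- Modulo x_a, either all x_v of the cluster A of a vanish (`Z₁`), or y_a vanishes as well (`Z₂`).
  -- The sum of these two ideals is given by `Z₃`. The first two have dimension one less than the
  -- original, the sum two less.
  let A : Finset V := W.filter (c · = c a)
  have hA : ∀ {v}, v ∈ A ↔ v ∈ W ∧ c v = c a := by simp [A]
  have haA : a ∈ A := hA.2 ⟨ha, rfl⟩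
  have hAW : A ⊆ W := Finset.filter_subset _ _
  let Z₁ : Finset (V ⊕ V) := Z ∪ A.image Sum.inl
  let Z₂ : Finset (V ⊕ V) := insert (Sum.inl a) (insert (Sum.inr a) Z)
  let Z₃ : Finset (V ⊕ V) := insert (Sum.inr a) Z₁
  have hZ₁ : ∀ {s}, s ∈ Z₁ ↔ s ∈ Z ∨ ∃ v ∈ A, Sum.inl v = s := by simp [Z₁]
  have hZW₁ : ∀ s ∈ Z₁, vertexOf s ∉ W \ A := by
    intro s hs h
    rcases hZ₁.1 hs with hs | ⟨v, hv, rfl⟩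
    · exact hZW s hs (Finset.mem_sdiff.1 h).1
    · exact (Finset.mem_sdiff.1 h).2 hv
  have hZW₂ : ∀ s ∈ Z₂, vertexOf s ∉ W.erase a := by
    intro s hs h
    rcases Finset.mem_insert.1 hs with rfl | hs
    · simp at h
    rcases Finset.mem_insert.1 hs with rfl | hs
    · simp at h
    · exact hZW s hs (Finset.mem_of_mem_erase h)
  have hZW₃ : ∀ s ∈ Z₃, vertexOf s ∉ W \ A := by
    intro s hs h
    rcases Finset.mem_insert.1 hs with rfl | hs
    · exact (Finset.mem_sdiff.1 h).2 haA
    · exact hZW₁ s hs h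
  have haZ₁ : Sum.inl a ∈ Z₁ := hZ₁.2 (Or.inr ⟨a, haA, rfl⟩)
  have h1 := ih _ (hcard Finset.subset_union_left haZ₁ haZ) Z₁ (W \ A) hZW₁ rfl
  have h2 := ih _ (hcard ((Finset.subset_insert _ _).trans (Finset.subset_insert _ _))
    (Finset.mem_insert_self _ _) haZ) Z₂ (W.erase a) hZW₂ rfl
  have h3 := ih _ (hcard (Finset.subset_union_left.trans (Finset.subset_insert _ _))
    (Finset.mem_insert_of_mem haZ₁) haZ) Z₃ (W \ A) hZW₃ rfl
  have hAcard : (W \ A).card + A.card = W.card := Finset.card_sdiff_add_card_eq_card hAW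
  have himg : (W.image c).card ≤ ((W \ A).image c).card + 1 := by
    refine (Finset.card_le_card (t := insert (c a) ((W \ A).image c)) ?_).trans
      (Finset.card_insert_le _ _)
    intro C hC
    obtain ⟨v, hv, rfl⟩ := Finset.mem_image.1 hC
    by_cases hva : c v = c a
    · exact Finset.mem_insert.2 (Or.inl hva)
    · exact Finset.mem_insert_of_mem (Finset.mem_image_of_mem c
        (Finset.mem_sdiff.2 ⟨hv, fun h => hva (hA.1 h).2⟩))
  have hinr : ∀ {v}, v ∈ A → Sum.inr v ∉ Z₁ := by
    intro v hv h
    rcases hZ₁.1 h with h | ⟨w, -, hw⟩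
    · exact hZW _ h (hAW hv)
    · exact Sum.inl_ne_inr hw
  have hd1 : clusterDim Z W c ≤ clusterDim Z₁ (W \ A) c + 1 := by
    have : A.card ≤ (Finset.univ.filter fun s => s ∉ Z₁ ∧ vertexOf s ∉ W \ A).card := by
      rw [← Finset.card_image_of_injective A (Sum.inr_injective (α := V))]
      refine Finset.card_le_card fun s hs => ?_
      obtain ⟨v, hv, rfl⟩ := Finset.mem_image.1 hs
      exact Finset.mem_filter.2 ⟨Finset.mem_univ _, hinr hv, fun h => (Finset.mem_sdiff.1 h).2 hv⟩
    rw [hdim0, clusterDim]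
    omega
  have hd2 : clusterDim Z W c ≤ clusterDim Z₂ (W.erase a) c + 1 := by
    -- The second vertex b keeps the label of a in use after a is erased.
    have : (W.image c).card ≤ ((W.erase a).image c).card := by
      refine Finset.card_le_card fun C hC => ?_
      obtain ⟨v, hv, rfl⟩ := Finset.mem_image.1 hC
      by_cases hva : v = a
      · exact Finset.mem_image.2 ⟨b, Finset.mem_erase.2 ⟨hba, hb⟩, hva ▸ hbc⟩
      · exact Finset.mem_image_of_mem c (Finset.mem_erase.2 ⟨hva, hv⟩)
    rw [hdim0, clusterDim, Finset.card_erase_of_mem ha]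
    omega
  have hd3 : clusterDim Z W c ≤ clusterDim Z₃ (W \ A) c + 2 := by
    have : (A.erase a).card ≤ (Finset.univ.filter fun s => s ∉ Z₃ ∧ vertexOf s ∉ W \ A).card := by
      rw [← Finset.card_image_of_injective (A.erase a) (Sum.inr_injective (α := V))]
      refine Finset.card_le_card fun s hs => ?_
      obtain ⟨v, hv, rfl⟩ := Finset.mem_image.1 hs
      obtain ⟨hva, hv⟩ := Finset.mem_erase.1 hv
      refine Finset.mem_filter.2 ⟨Finset.mem_univ _, fun h => ?_,
        fun h => (Finset.mem_sdiff.1 h).2 hv⟩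
      rcases Finset.mem_insert.1 h with h | h
      · exact hva (Sum.inr_injective h)
      · exact hinr hv h
    rw [Finset.card_erase_of_mem haA] at this
    rw [hdim0, clusterDim]
    omega
  have hpos : 0 < (W.image c).card := Finset.card_pos.2 ⟨c a, Finset.mem_image_of_mem c ha⟩
  obtain ⟨k, hk⟩ : ∃ k, clusterDim Z W c = k + 2 := ⟨clusterDim Z W c - 2, by omega⟩
  rw [hk] at hd1 hd2 hd3 ⊢
  set L : Ideal (PolyRing K V) := clusterIdeal K Z W c ⊔ Ideal.span {X (Sum.inl a)} with hL
  have hxL : (X (Sum.inl a) : PolyRing K V) ∈ L :=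
    Ideal.mem_sup_right (Ideal.mem_span_singleton_self _)
  have hsup : clusterIdeal K Z₁ (W \ A) c ⊔ clusterIdeal K Z₂ (W.erase a) c =
      clusterIdeal K Z₃ (W \ A) c := by
    apply le_antisymm
    · refine sup_le (clusterIdeal_le (fun s hs => X_mem_clusterIdeal (Finset.mem_insert_of_mem hs))
        fun i hi j hj hc => binomial_mem_clusterIdeal hi hj hc)
        (clusterIdeal_le (fun s hs => X_mem_clusterIdeal ?_) fun i hi j hj hc => ?_)
      · simp only [Z₂, Z₃, Z₁, Finset.mem_insert, Finset.mem_union, Finset.mem_image] at hs ⊢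
        rcases hs with rfl | rfl | hs
        exacts [Or.inr (Or.inr ⟨a, haA, rfl⟩), Or.inl rfl, Or.inr (Or.inl hs)]
      · have hi' := Finset.mem_of_mem_erase hi
        have hj' := Finset.mem_of_mem_erase hj
        by_cases hia : c i = c a
        · have hXi : (x K i) ∈ clusterIdeal K Z₃ (W \ A) c := X_mem_clusterIdeal
            (Finset.mem_insert_of_mem (hZ₁.2 (Or.inr ⟨i, hA.2 ⟨hi', hia⟩, rfl⟩)))
          have hXj : (x K j) ∈ clusterIdeal K Z₃ (W \ A) c := X_mem_clusterIdeal
            (Finset.mem_insert_of_mem (hZ₁.2 (Or.inr ⟨j, hA.2 ⟨hj', hc ▸ hia⟩, rfl⟩)))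
          exact sub_mem (Ideal.mul_mem_right _ _ hXi) (Ideal.mul_mem_right _ _ hXj)
        · exact binomial_mem_clusterIdeal
            (Finset.mem_sdiff.2 ⟨hi', fun h => hia (hA.1 h).2⟩)
            (Finset.mem_sdiff.2 ⟨hj', fun h => hia (hc.trans (hA.1 h).2)⟩) hc
    · refine clusterIdeal_le (fun s hs => ?_) fun i hi j hj hc =>
        Ideal.mem_sup_left (binomial_mem_clusterIdeal hi hj hc)
      rcases Finset.mem_insert.1 hs with rfl | hs
      · exact Ideal.mem_sup_right (X_mem_clusterIdeal (by simp [Z₂]))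
      · exact Ideal.mem_sup_left (X_mem_clusterIdeal hs)
  have hle : L ≤ clusterIdeal K Z₁ (W \ A) c ⊓ clusterIdeal K Z₂ (W.erase a) c := by
    refine sup_le (clusterIdeal_le (fun s hs => ⟨X_mem_clusterIdeal (hZ₁.2 (Or.inl hs)),
      X_mem_clusterIdeal (by simp [Z₂, hs])⟩) fun i hi j hj hc => ⟨?_, ?_⟩) ?_
    · by_cases hia : c i = c a
      · have hXi : (x K i) ∈ clusterIdeal K Z₁ (W \ A) c := X_mem_clusterIdeal
          (hZ₁.2 (Or.inr ⟨i, hA.2 ⟨hi, hia⟩, rfl⟩))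
        have hXj : (x K j) ∈ clusterIdeal K Z₁ (W \ A) c := X_mem_clusterIdeal
          (hZ₁.2 (Or.inr ⟨j, hA.2 ⟨hj, hc ▸ hia⟩, rfl⟩))
        exact sub_mem (Ideal.mul_mem_right _ _ hXi) (Ideal.mul_mem_right _ _ hXj)
      · exact binomial_mem_clusterIdeal
          (Finset.mem_sdiff.2 ⟨hi, fun h => hia (hA.1 h).2⟩)
          (Finset.mem_sdiff.2 ⟨hj, fun h => hia (hc.trans (hA.1 h).2)⟩) hc
    · have hxa : x K a ∈ clusterIdeal K Z₂ (W.erase a) c := X_mem_clusterIdeal (by simp [Z₂])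
      have hya : y K a ∈ clusterIdeal K Z₂ (W.erase a) c := X_mem_clusterIdeal (by simp [Z₂])
      by_cases hia : i = a
      · subst hia
        exact sub_mem (Ideal.mul_mem_right _ _ hxa) (Ideal.mul_mem_left _ _ hya)
      · by_cases hja : j = a
        · subst hja
          exact sub_mem (Ideal.mul_mem_left _ _ hya) (Ideal.mul_mem_right _ _ hxa)
        · exact binomial_mem_clusterIdeal (Finset.mem_erase.2 ⟨hia, hi⟩)
            (Finset.mem_erase.2 ⟨hja, hj⟩) hc
    · rw [Ideal.span_singleton_le_iff_mem]
      exact ⟨X_mem_clusterIdeal haZ₁, X_mem_clusterIdeal (by simp [Z₂])⟩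
  -- Modulo L such an element is a multiple q y_a. The first ideal is prime and does not contain
  -- y_a, so it contains q. Finally y_a times that ideal lies in L, because y_a x_v ≡ x_a y_v modulo
  -- L for v in A.
  have hge : clusterIdeal K Z₁ (W \ A) c ⊓ clusterIdeal K Z₂ (W.erase a) c ≤ L := by
    rintro f ⟨hf1, hf2⟩
    have hsplit : clusterIdeal K Z₂ (W.erase a) c ≤
        clusterIdeal K (insert (Sum.inl a) Z) (W.erase a) c ⊔ Ideal.span {X (Sum.inr a)} := by
      refine clusterIdeal_le (fun s hs => ?_) fun i hi j hj hc =>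
        Ideal.mem_sup_left (binomial_mem_clusterIdeal hi hj hc)
      simp only [Z₂, Finset.mem_insert] at hs
      rcases hs with rfl | rfl | hs
      · exact Ideal.mem_sup_left (X_mem_clusterIdeal (by simp))
      · exact Ideal.mem_sup_right (Ideal.mem_span_singleton_self _)
      · exact Ideal.mem_sup_left (X_mem_clusterIdeal (by simp [hs]))
    obtain ⟨g, hg, h, hh, rfl⟩ := Submodule.mem_sup.1 (hsplit hf2)
    have hgL : clusterIdeal K (insert (Sum.inl a) Z) (W.erase a) c ≤ L := by
      refine clusterIdeal_le (fun s hs => ?_) fun i hi j hj hc => Ideal.mem_sup_left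
        (binomial_mem_clusterIdeal (Finset.mem_of_mem_erase hi) (Finset.mem_of_mem_erase hj) hc)
      rcases Finset.mem_insert.1 hs with rfl | hs
      · exact hxL
      · exact Ideal.mem_sup_left (X_mem_clusterIdeal hs)
    have hg1 := (hle (hgL hg)).1
    have hh1 : h ∈ clusterIdeal K Z₁ (W \ A) c := by
      simpa using sub_mem hf1 hg1
    obtain ⟨q, rfl⟩ := Ideal.mem_span_singleton'.1 hh
    rw [mul_comm] at hh1
    have hq := mem_of_X_mul_mem_clusterIdeal hZW₁ (hinr haA) hh1
    have hmul : clusterIdeal K Z₁ (W \ A) c ≤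
        Submodule.comap (LinearMap.mulLeft (PolyRing K V) (y K a)) L := by
      refine clusterIdeal_le (fun s hs => ?_) fun i hi j hj hc => ?_
      · rw [Submodule.mem_comap, LinearMap.mulLeft_apply]
        rcases hZ₁.1 hs with hs | ⟨v, hv, rfl⟩
        · exact Ideal.mul_mem_left _ _ (Ideal.mem_sup_left (X_mem_clusterIdeal hs))
        · change y K a * x K v ∈ L
          rw [show y K a * x K v = x K a * y K v - (x K a * y K v - x K v * y K a) by ring]
          exact sub_mem (Ideal.mul_mem_right _ _ hxL) (Ideal.mem_sup_left
            (binomial_mem_clusterIdeal ha (hAW hv) (hA.1 hv).2.symm))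
      · rw [Submodule.mem_comap, LinearMap.mulLeft_apply]
        exact Ideal.mul_mem_left _ _ (Ideal.mem_sup_left (binomial_mem_clusterIdeal
          (Finset.mem_sdiff.1 hi).1 (Finset.mem_sdiff.1 hj).1 hc))
    refine add_mem (hgL hg) ?_
    have := hmul hq
    rw [Submodule.mem_comap, LinearMap.mulLeft_apply] at this
    rw [mul_comm]
    exact this
  refine ExtVanish.quotient_regular (X_mem_homogeneousMaximalIdeal _) hreg hL
    (ExtVanish.quotient_inf (le_antisymm hle hge) (h1.mono (by omega)) (h2.mono (by omega)) ?_)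
  rw [hsup]
  exact h3.mono (by omega)

end ClusterDepth

/-! ### Completing the neighbourhood of a vertex and isolating a vertex -/

section Operations

variable {V : Type*}

/-- The graph obtained from `G` by making the neighbourhood of `v` complete. -/
def completeAt (G : SimpleGraph V) (v : V) : SimpleGraph V where
  Adj a b := a ≠ b ∧ (G.Adj a b ∨ G.Adj v a ∧ G.Adj v b)
  symm := ⟨fun _ _ h => ⟨h.1.symm, h.2.imp (fun h => G.adj_symm h) And.symm⟩⟩
  loopless := ⟨fun _ h => h.1 rfl⟩

/-- The graph obtained from `G` by deleting all edges at `v`. -/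
def isolate (G : SimpleGraph V) (v : V) : SimpleGraph V where
  Adj a b := G.Adj a b ∧ a ≠ v ∧ b ≠ v
  symm := ⟨fun _ _ h => ⟨h.1.symm, h.2.2, h.2.1⟩⟩
  loopless := ⟨fun _ h => G.loopless.irrefl _ h.1⟩

variable {G : SimpleGraph V} {v : V}

lemma le_completeAt : G ≤ completeAt G v := fun _ _ h => ⟨h.ne, Or.inl h⟩

lemma isolate_le : isolate G v ≤ G := fun _ _ h => h.1

end Operations

/-! ### The decomposition of a binomial edge ideal at a vertex -/

section Decomposition

open MvPolynomial

variable (K : Type u) [Field K] {V : Type}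

/-- The ideal generated by `J_G` and the variables of the vertices outside `W`. -/
def graphIdeal (W : Finset V) (G : SimpleGraph V) : Ideal (PolyRing K V) :=
  Ideal.span {p | (∃ s, vertexOf s ∉ W ∧ p = X s) ∨
    ∃ i j, G.Adj i j ∧ p = x K i * y K j - x K j * y K i}

variable {K} {W : Finset V} {G : SimpleGraph V}

lemma X_mem_graphIdeal {s : V ⊕ V} (hs : vertexOf s ∉ W) :
    (X s : PolyRing K V) ∈ graphIdeal K W G :=
  Ideal.subset_span (Or.inl ⟨s, hs, rfl⟩)

lemma binomial_mem_graphIdeal {i j : V} (h : G.Adj i j) :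
    x K i * y K j - x K j * y K i ∈ graphIdeal K W G :=
  Ideal.subset_span (Or.inr ⟨i, j, h, rfl⟩)

lemma graphIdeal_le {L : Ideal (PolyRing K V)}
    (hW : ∀ s, vertexOf s ∉ W → (X s : PolyRing K V) ∈ L)
    (hG : ∀ i j, G.Adj i j → x K i * y K j - x K j * y K i ∈ L) : graphIdeal K W G ≤ L := by
  refine Ideal.span_le.2 ?_
  rintro p (⟨s, hs, rfl⟩ | ⟨i, j, h, rfl⟩)
  · exact hW s hs
  · exact hG i j h

lemma graphIdeal_univ [Fintype V] : graphIdeal K Finset.univ G = binomialEdgeIdeal K G := by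
  rw [graphIdeal, binomialEdgeIdeal]
  congr 1
  ext p
  simp

variable {v : V}

/-- The Plücker-type syzygy of the 2 × 3 matrix with columns v, i, j. -/
lemma mul_binomial_mem_graphIdeal {i j : V} (hi : G.Adj v i) (hj : G.Adj v j) {f : PolyRing K V}
    (hf : f ∈ Ideal.span {x K v, y K v}) :
    f * (x K i * y K j - x K j * y K i) ∈ graphIdeal K W G := by
  obtain ⟨a, b, rfl⟩ := Ideal.mem_span_pair.1 hf
  rw [show (a * x K v + b * y K v) * (x K i * y K j - x K j * y K i) =
    (a * x K i + b * y K i) * (x K v * y K j - x K j * y K v) -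
      (a * x K j + b * y K j) * (x K v * y K i - x K i * y K v) by ring]
  exact sub_mem (Ideal.mul_mem_left _ _ (binomial_mem_graphIdeal hj))
    (Ideal.mul_mem_left _ _ (binomial_mem_graphIdeal hi))

variable [DecidableEq V]

variable (K) in
/-- The substitution of `0` for both variables of the vertex `v`. -/
def killVertex (v : V) : PolyRing K V →ₐ[K] PolyRing K V :=
  aeval fun s => if vertexOf s = v then 0 else X s

lemma killVertex_x (w : V) : killVertex K v (x K w) = if w = v then 0 else x K w := by
  rw [killVertex, x, aeval_X]; rfl

lemma killVertex_y (w : V) : killVertex K v (y K w) = if w = v then 0 else y K w := by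
  rw [killVertex, y, aeval_X]; rfl

lemma killVertex_mem_graphIdeal {f : PolyRing K V} (hf : f ∈ graphIdeal K (W.erase v) G) :
    killVertex K v f ∈ graphIdeal K W G := by
  have h : graphIdeal K (W.erase v) G ≤ Ideal.comap (killVertex K v) (graphIdeal K W G) := by
    refine graphIdeal_le (fun s hs => ?_) fun i j hij => ?_
    · rw [Ideal.mem_comap, killVertex, aeval_X]
      split_ifs with h
      · exact zero_mem _
      · exact X_mem_graphIdeal fun h' => hs (Finset.mem_erase.2 ⟨h, h'⟩)
    · rw [Ideal.mem_comap]
      simp only [map_sub, map_mul, killVertex_x, killVertex_y]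
      by_cases hi : i = v
      · simp [hi]
      · by_cases hj : j = v
        · simp [hj]
        · simpa [hi, hj] using binomial_mem_graphIdeal hij
  exact h hf

lemma sub_killVertex_mem (f : PolyRing K V) :
    f - killVertex K v f ∈ Ideal.span {x K v, y K v} := by
  rw [← Ideal.Quotient.eq]
  have h : (Ideal.Quotient.mkₐ K (Ideal.span {x K v, y K v})).comp (killVertex K v) =
      Ideal.Quotient.mkₐ K (Ideal.span {x K v, y K v}) := by
    refine MvPolynomial.algHom_ext fun s => ?_
    rw [AlgHom.comp_apply, killVertex, aeval_X]
    split_ifs with hs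
    · rw [map_zero]
      refine (Ideal.Quotient.eq_zero_iff_mem.2 (Ideal.subset_span ?_)).symm
      subst hs
      rcases s with s | s
      · exact Or.inl rfl
      · exact Or.inr rfl
    · rfl
  exact (AlgHom.congr_fun h f).symm

/-- Write an element of the intersection as g + e, with g in the ideal of G and e a combination of
binomials on neighbours of v. Setting x_v = y_v = 0 sends the element and g into the ideal of G,
hence e too. It changes e only by a multiple of such binomials with coefficients in (x_v, y_v),
which lies in that ideal. -/
theorem graphIdeal_eq_inf (W : Finset V) (G : SimpleGraph V) (v : V) :
    graphIdeal K W G =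
      graphIdeal K W (completeAt G v) ⊓ graphIdeal K (W.erase v) (isolate G v) := by
  have hle : graphIdeal K (W.erase v) (isolate G v) = graphIdeal K (W.erase v) G := by
    apply le_antisymm
    · exact graphIdeal_le (fun s hs => X_mem_graphIdeal hs)
        fun i j h => binomial_mem_graphIdeal (isolate_le h)
    · refine graphIdeal_le (fun s hs => X_mem_graphIdeal hs) fun i j h => ?_
      have hx : x K v ∈ graphIdeal K (W.erase v) (isolate G v) := X_mem_graphIdeal (by simp)
      have hy : y K v ∈ graphIdeal K (W.erase v) (isolate G v) := X_mem_graphIdeal (by simp)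
      by_cases hi : i = v
      · subst hi
        exact sub_mem (Ideal.mul_mem_right _ _ hx) (Ideal.mul_mem_left _ _ hy)
      · by_cases hj : j = v
        · subst hj
          exact sub_mem (Ideal.mul_mem_left _ _ hy) (Ideal.mul_mem_right _ _ hx)
        · exact binomial_mem_graphIdeal ⟨h, hi, hj⟩
  rw [hle]
  apply le_antisymm
  · refine le_inf (graphIdeal_le (fun s hs => X_mem_graphIdeal hs)
      fun i j h => binomial_mem_graphIdeal (le_completeAt h))
      (graphIdeal_le (fun s hs => X_mem_graphIdeal fun h => hs (Finset.mem_of_mem_erase h))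
      fun i j h => binomial_mem_graphIdeal h)
  · rintro f ⟨hf, hf'⟩
    have hkill : graphIdeal K W (completeAt G v) ≤
        graphIdeal K W G ⊔ Ideal.span {p | ∃ i j, G.Adj v i ∧ G.Adj v j ∧
          p = x K i * y K j - x K j * y K i} := by
      refine graphIdeal_le (fun s hs => Ideal.mem_sup_left (X_mem_graphIdeal hs)) fun i j h => ?_
      rcases h.2 with h | h
      · exact Ideal.mem_sup_left (binomial_mem_graphIdeal h)
      · exact Ideal.mem_sup_right (Ideal.subset_span ⟨i, j, h.1, h.2, rfl⟩)
    obtain ⟨g, hg, e, he, rfl⟩ := Submodule.mem_sup.1 (hkill hf)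
    have hsub : e - killVertex K v e ∈ graphIdeal K W G := by
      refine Submodule.span_induction (p := fun e _ => e - killVertex K v e ∈ graphIdeal K W G)
        ?_ ?_ ?_ ?_ he
      · rintro _ ⟨i, j, hi, hj, rfl⟩
        simp only [map_sub, map_mul, killVertex_x, killVertex_y, if_neg hi.ne', if_neg hj.ne',
          sub_self]
        exact zero_mem _
      · simp
      · intro a b _ _ ha hb
        rw [map_add, add_sub_add_comm]
        exact add_mem ha hb
      · intro a b hb hb'
        rw [smul_eq_mul, map_mul, show a * b - killVertex K v a * killVertex K v b =
          (a - killVertex K v a) * b + killVertex K v a * (b - killVertex K v b) by ring]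
        refine add_mem ?_ (Ideal.mul_mem_left _ _ hb')
        refine Submodule.span_induction
          (p := fun b _ => (a - killVertex K v a) * b ∈ graphIdeal K W G) ?_ ?_ ?_ ?_ hb
        · rintro _ ⟨i, j, hi, hj, rfl⟩
          exact mul_binomial_mem_graphIdeal hi hj (sub_killVertex_mem a)
        · simp
        · intro c d _ _ hc hd
          rw [mul_add]
          exact add_mem hc hd
        · intro c d _ hd
          rw [smul_eq_mul, mul_left_comm]
          exact Ideal.mul_mem_left _ _ hd
    have h1 := killVertex_mem_graphIdeal hf'
    have h2 : killVertex K v g ∈ graphIdeal K W G := by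
      refine killVertex_mem_graphIdeal (graphIdeal_le (fun s hs => X_mem_graphIdeal fun h =>
        hs (Finset.mem_of_mem_erase h)) (fun i j h => binomial_mem_graphIdeal h) hg)
    rw [map_add] at h1
    have h3 := add_mem hsub ((Ideal.add_mem_iff_right _ h2).1 h1)
    rw [sub_add_cancel] at h3
    exact add_mem hg h3

theorem graphIdeal_sup (W : Finset V) (G : SimpleGraph V) (v : V) :
    graphIdeal K W (completeAt G v) ⊔ graphIdeal K (W.erase v) (isolate G v) =
      graphIdeal K (W.erase v) (isolate (completeAt G v) v) := by
  have hx : ∀ H, x K v ∈ graphIdeal K (W.erase v) H := fun H => X_mem_graphIdeal (by simp)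
  have hy : ∀ H, y K v ∈ graphIdeal K (W.erase v) H := fun H => X_mem_graphIdeal (by simp)
  apply le_antisymm
  · refine sup_le (graphIdeal_le (fun s hs => X_mem_graphIdeal fun h =>
      hs (Finset.mem_of_mem_erase h)) fun i j h => ?_) (graphIdeal_le
      (fun s hs => X_mem_graphIdeal hs) fun i j h =>
      binomial_mem_graphIdeal ⟨le_completeAt h.1, h.2⟩)
    by_cases hi : i = v
    · subst hi
      exact sub_mem (Ideal.mul_mem_right _ _ (hx _)) (Ideal.mul_mem_left _ _ (hy _))
    · by_cases hj : j = v
      · subst hj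
        exact sub_mem (Ideal.mul_mem_left _ _ (hy _)) (Ideal.mul_mem_right _ _ (hx _))
      · exact binomial_mem_graphIdeal ⟨h, hi, hj⟩
  · exact graphIdeal_le (fun s hs => Ideal.mem_sup_right (X_mem_graphIdeal hs))
      fun i j h => Ideal.mem_sup_left (binomial_mem_graphIdeal h.1)

end Decomposition

/-! ### The sum of the diameters -/

section DiamSum

open SimpleGraph

variable {V : Type*}

open Classical in
/-- The distance of two vertices, increased by one if the first of them is isolated. -/
def weight (G : SimpleGraph V) (u w : V) : ℕ :=
  G.dist u w + if G.IsIsolated u then 1 else 0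

variable {G H : SimpleGraph V}

lemma dist_le_weight (G : SimpleGraph V) (u w : V) : G.dist u w ≤ weight G u w :=
  Nat.le_add_right _ _

lemma weight_of_isIsolated {v : V} (h : G.IsIsolated v) : 1 ≤ weight G v v := by
  simp [weight, h]

lemma exists_one_le_weight (G : SimpleGraph V) (v : V) :
    ∃ w, G.Reachable v w ∧ 1 ≤ weight G v w := by
  by_cases h : G.IsIsolated v
  · exact ⟨v, Reachable.refl v, weight_of_isIsolated h⟩
  · obtain ⟨w, hw⟩ := exists_adj_iff_not_isIsolated.2 h
    exact ⟨w, hw.reachable, (dist_eq_one_iff_adj.2 hw).ge.trans (dist_le_weight G v w)⟩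

lemma eq_of_reachable_of_isIsolated {v w : V} (h : G.IsIsolated v) (hr : G.Reachable v w) :
    v = w := by
  obtain ⟨p⟩ := hr
  cases p with
  | nil => rfl
  | cons h' _ => exact absurd h' (h _)

variable [Finite V]

lemma dist_le_diam_component {u w : V} (h : G.Reachable u w) :
    G.dist u w ≤ (G.connectedComponentMk u).toSimpleGraph.diam := by
  set C := G.connectedComponentMk u with hC
  have hu : u ∈ C := rfl
  have hw : w ∈ C := (ConnectedComponent.eq.2 h).symm
  have hne : Nonempty C := ⟨⟨u, hu⟩⟩
  have hfin : C.toSimpleGraph.ediam ≠ ⊤ := connected_iff_ediam_ne_top.1 C.connected_toSimpleGraph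
  refine le_trans ?_ (dist_le_diam hfin (u := ⟨u, hu⟩) (v := ⟨w, hw⟩))
  obtain ⟨p, hp⟩ := (C.reachable_toSimpleGraph hu hw).exists_walk_length_eq_dist
  rw [← hp, ← Walk.length_map C.toSimpleGraph_hom p]
  exact dist_le _

/-- Together with `diamSum_le_sum_weight` this describes `diamSum` as the maximal total weight of
pairs chosen in distinct components, so lower bounds only need well-chosen pairs. -/
lemma sum_weight_le_diamSum {ι : Type*} [Fintype ι] (u w : ι → V)
    (hr : ∀ i, G.Reachable (u i) (w i)) (hd : ∀ i j, G.Reachable (u i) (u j) → i = j) :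
    ∑ i, weight G (u i) (w i) ≤ diamSum G := by
  classical
  have := Fintype.ofFinite V
  have := Fintype.ofFinite G.ConnectedComponent
  have hinj : Function.Injective fun i => G.connectedComponentMk (u i) :=
    fun i j hij => hd i j (ConnectedComponent.eq.1 hij)
  simp only [weight, Finset.sum_add_distrib]
  rw [diamSum, finsum_eq_sum_of_fintype, add_comm]
  refine add_le_add ?_ ?_
  · rw [Finset.sum_boole, Nat.cast_id, ← Finset.card_image_of_injective _
      (fun i j hij => hd i j (by rw [hij]) : Function.Injective u), ← Set.ncard_coe_finset]
    refine Set.ncard_le_ncard (fun v hv => ?_) (Set.toFinite _)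
    obtain ⟨i, hi, rfl⟩ := Finset.mem_image.1 (Finset.mem_coe.1 hv)
    exact (Finset.mem_filter.1 hi).2
  · calc ∑ i, G.dist (u i) (w i)
        ≤ ∑ i, (G.connectedComponentMk (u i)).toSimpleGraph.diam :=
          Finset.sum_le_sum fun i _ => dist_le_diam_component (hr i)
      _ = ∑ C ∈ Finset.univ.image fun i => G.connectedComponentMk (u i), C.toSimpleGraph.diam :=
          (Finset.sum_image (f := fun C : G.ConnectedComponent => C.toSimpleGraph.diam)
            fun i _ j _ hij => hinj hij).symm
      _ ≤ _ := Finset.sum_le_sum_of_subset (Finset.subset_univ _)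

omit [Finite V] in
lemma exists_diam_le_dist (C : G.ConnectedComponent) :
    ∃ u w, G.connectedComponentMk u = C ∧ G.connectedComponentMk w = C ∧
      C.toSimpleGraph.diam ≤ G.dist u w := by
  have hne : Nonempty C := C.connected_toSimpleGraph.nonempty
  obtain ⟨⟨u, hu⟩, ⟨w, hw⟩, hd⟩ := exists_dist_eq_diam (G := C.toSimpleGraph)
  refine ⟨u, w, hu, hw, ?_⟩
  rw [← hd]
  obtain ⟨p, hp⟩ := (C.reachable_of_mem_supp hu hw).exists_walk_length_eq_dist
  rw [← hp]
  have hsupp : ∀ x ∈ p.support, x ∈ C.supp := fun x hx =>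
    by
    classical
    exact (ConnectedComponent.sound (p.takeUntil x hx).reachable).symm.trans hu
  have hle := dist_le (p.induce C.supp hsupp)
  rwa [← Walk.length_map (Embedding.induce C.supp).toHom, Walk.map_induce] at hle

lemma diamSum_le_sum_weight [Fintype G.ConnectedComponent] (u w : G.ConnectedComponent → V)
    (hu : ∀ C, G.connectedComponentMk (u C) = C)
    (hd : ∀ C, C.toSimpleGraph.diam ≤ G.dist (u C) (w C)) :
    diamSum G ≤ ∑ C, weight G (u C) (w C) := by
  classical
  simp only [weight, Finset.sum_add_distrib]
  rw [diamSum, finsum_eq_sum_of_fintype, add_comm]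
  refine add_le_add (Finset.sum_le_sum fun C _ => hd C) ?_
  have huniq : ∀ v, G.IsIsolated v → u (G.connectedComponentMk v) = v := fun v hv =>
    (eq_of_reachable_of_isIsolated hv (ConnectedComponent.eq.1 (hu _)).symm).symm
  rw [Finset.sum_boole, Nat.cast_id, ← Set.ncard_coe_finset]
  refine Set.ncard_le_ncard_of_injOn G.connectedComponentMk (fun v hv => ?_)
    (fun v hv v' hv' h => ?_)
    (Set.toFinite _)
  · have hv' : G.IsIsolated v := hv
    simpa [huniq v hv'] using hv'
  · rw [← huniq v hv, h, huniq v' hv']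

omit [Finite V] in
lemma exists_walk_of_agree {P : V → Prop} (hP : ∀ a b, P a → G.Adj a b → P b)
    (h : ∀ a b, P a → G.Adj a b → H.Adj a b) {a b : V} (p : G.Walk a b) (ha : P a) :
    ∃ q : H.Walk a b, q.length = p.length := by
  induction p with
  | nil => exact ⟨Walk.nil, rfl⟩
  | cons hab p ih =>
    obtain ⟨q, hq⟩ := ih (hP _ _ ha hab)
    exact ⟨Walk.cons (h _ _ ha hab) q, by simp [hq]⟩

/-- Comparison of `diamSum` for two graphs which agree outside the component of `v` in the first
one: the component of `v` may be replaced by any family of pairs in distinct components of the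
second graph. -/
lemma diamSum_add_sum_weight_le {v : V} (hv : ¬ G.IsIsolated v)
    (hagree : ∀ a b, ¬ G.Reachable v a → (H.Adj a b ↔ G.Adj a b))
    (hreach : ∀ a b, H.Adj a b → G.Reachable a b) {κ : Type} [Fintype κ] (u w : κ → V)
    (huv : ∀ i, G.Reachable v (u i)) (hr : ∀ i, H.Reachable (u i) (w i))
    (hd : ∀ i j, H.Reachable (u i) (u j) → i = j) :
    diamSum G + ∑ i, weight H (u i) (w i) ≤
      diamSum H + (G.connectedComponentMk v).toSimpleGraph.diam := by
  classical
  have := Fintype.ofFinite V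
  have := Fintype.ofFinite G.ConnectedComponent
  have hHG : ∀ {a b}, H.Reachable a b → G.Reachable a b := by
    rintro a b ⟨p⟩
    induction p with
    | nil => exact Reachable.refl _
    | cons h _ ih => exact (hreach _ _ h).trans ih
  choose u₀ w₀ hu₀ hw₀ hd₀ using exists_diam_le_dist (G := G)
  set C₀ := G.connectedComponentMk v with hC₀
  have hP : ∀ a b, ¬ G.Reachable v a → G.Reachable a b → ¬ G.Reachable v b :=
    fun a b ha hab hb => ha (hb.trans hab.symm)
  have hwalk : ∀ {a b}, ¬ G.Reachable v a → ∀ p : G.Walk a b, ∃ q : H.Walk a b,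
      q.length = p.length := fun ha p => exists_walk_of_agree
    (fun a b ha hab => hP a b ha hab.reachable) (fun a b ha hab => (hagree a b ha).2 hab) p ha
  have hwalk' : ∀ {a b}, ¬ G.Reachable v a → ∀ p : H.Walk a b, ∃ q : G.Walk a b,
      q.length = p.length := fun ha p => exists_walk_of_agree
    (fun a b ha hab => hP a b ha (hreach a b hab)) (fun a b ha hab => (hagree a b ha).1 hab) p ha
  have hne : ∀ C : {C // C ≠ C₀}, ¬ G.Reachable v (u₀ C) := fun C h =>
    C.2 ((hu₀ C).symm.trans (ConnectedComponent.sound h).symm)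
  have hreach₀ : ∀ C, G.Reachable (u₀ C) (w₀ C) := fun C =>
    ConnectedComponent.eq.1 ((hu₀ C).trans (hw₀ C).symm)
  have hreach₁ : ∀ C : {C // C ≠ C₀}, H.Reachable (u₀ C) (w₀ C) := fun C =>
    (hwalk (hne C) (hreach₀ C).some).choose.reachable
  have hweight : ∀ C : {C // C ≠ C₀}, weight G (u₀ C) (w₀ C) ≤ weight H (u₀ C) (w₀ C) := by
    intro C
    refine add_le_add ?_ ?_
    · obtain ⟨p, hp⟩ := (hreach₁ C).exists_walk_length_eq_dist
      obtain ⟨q, hq⟩ := hwalk' (hne C) p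
      rw [← hp, ← hq]
      exact dist_le q
    · have : G.IsIsolated (u₀ C) ↔ H.IsIsolated (u₀ C) :=
        forall_congr' fun b => not_congr (hagree _ b (hne C)).symm
      simp only [this, le_refl]
  have hsum := diamSum_le_sum_weight u₀ w₀ hu₀ hd₀
  have hsplit := Fintype.sum_eq_add_sum_subtype_ne (fun C => weight G (u₀ C) (w₀ C)) C₀
  -- The component of v is not a single vertex, so its weight has no isolation term.
  have hC₀w : weight G (u₀ C₀) (w₀ C₀) ≤ C₀.toSimpleGraph.diam := by
    have hiso : ¬ G.IsIsolated (u₀ C₀) := by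
      intro h
      have := eq_of_reachable_of_isIsolated h (ConnectedComponent.eq.1 ((hu₀ C₀).trans hC₀))
      exact hv (this ▸ h)
    rw [weight, if_neg hiso, add_zero]
    have := dist_le_diam_component (hreach₀ C₀)
    rwa [hu₀ C₀] at this
  have hH := sum_weight_le_diamSum (G := H) (ι := {C // C ≠ C₀} ⊕ κ)
    (Sum.elim (fun C => u₀ C) u) (Sum.elim (fun C => w₀ C) w) ?_ ?_
  · rw [Fintype.sum_sum_type] at hH
    simp only [Sum.elim_inl, Sum.elim_inr] at hH
    have := Finset.sum_le_sum fun C (_ : C ∈ Finset.univ) => hweight C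
    omega
  · rintro (C | i)
    exacts [hreach₁ C, hr i]
  · rintro (C | i) (C' | j) h
    · have h' := ConnectedComponent.sound (hHG h)
      simp only [Sum.elim_inl, hu₀] at h'
      rw [Subtype.ext h']
    · exact absurd ((huv j).trans (hHG h).symm) (hne C)
    · exact absurd ((huv i).trans (hHG h)) (hne C')
    · rw [hd i j h]

omit [Finite V] in
lemma eq_or_adj_of_reachable (hfree : ∀ v, IsFreeVertex G v) {a b : V} (h : G.Reachable a b) :
    a = b ∨ G.Adj a b := by
  obtain ⟨p⟩ := h
  induction p with
  | nil => exact Or.inl rfl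
  | @cons a b c hab p ih =>
    rcases ih with rfl | hbc
    · exact Or.inr hab
    · by_cases hac : a = c
      · exact Or.inl hac
      · exact Or.inr (hfree b hab.symm hbc hac)

/-- Components are cliques: one with an edge has diameter 1, and a single vertex counts 1 as
isolated. -/
lemma diamSum_le_card_of_forall_isFreeVertex (hfree : ∀ v, IsFreeVertex G v) :
    diamSum G ≤ Nat.card G.ConnectedComponent := by
  classical
  have := Fintype.ofFinite V
  have := Fintype.ofFinite G.ConnectedComponent
  choose u w hu hw hd using exists_diam_le_dist (G := G)
  refine (diamSum_le_sum_weight u w hu hd).trans ?_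
  rw [Nat.card_eq_fintype_card, ← Finset.card_univ, Finset.card_eq_sum_ones]
  refine Finset.sum_le_sum fun C _ => ?_
  rcases eq_or_adj_of_reachable hfree (ConnectedComponent.eq.1 ((hu C).trans (hw C).symm)) with
    h | h
  · rw [weight, ← h, dist_self, zero_add]
    split_ifs <;> simp
  · rw [weight, dist_eq_one_iff_adj.2 h, if_neg fun h' => h' _ h]

end DiamSum

/-! ### Behaviour of the invariants under completing and isolating -/

section Selection

open SimpleGraph

variable {V : Type*} {G : SimpleGraph V} {v : V}

lemma isFreeVertex_completeAt_self : IsFreeVertex (completeAt G v) v := by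
  intro a ha b hb hab
  have hva : G.Adj v a := ha.2.elim id And.right
  have hvb : G.Adj v b := hb.2.elim id And.right
  exact ⟨hab, Or.inr ⟨hva, hvb⟩⟩

lemma isIsolated_isolate : (isolate G v).IsIsolated v := fun _ h => h.2.1 rfl

lemma isFreeVertex_isolate_self : IsFreeVertex (isolate G v) v :=
  fun _ ha => absurd ha (isIsolated_isolate _)

lemma IsFreeVertex.isolate {s : V} (h : IsFreeVertex G s) : IsFreeVertex (isolate G v) s :=
  fun _ ha _ hb hab => ⟨h ha.1 hb.1 hab, ha.2.2, hb.2.2⟩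

lemma IsFreeVertex.completeAt {s : V} (h : IsFreeVertex G s) :
    IsFreeVertex (completeAt G v) s := by
  intro a ha b hb hab
  by_cases hsv : G.Adj v s
  · have key : ∀ c, (BinomialEdge.completeAt G v).Adj s c → c = v ∨ G.Adj v c := by
      intro c hc
      by_cases hcv : c = v
      · exact Or.inl hcv
      · exact Or.inr (hc.2.elim (fun h' => h hsv.symm h' (Ne.symm hcv)) And.right)
    rcases key a ha with rfl | ha'
    · exact le_completeAt ((key b hb).resolve_left hab.symm)
    · rcases key b hb with rfl | hb'
      · exact le_completeAt ha'.symm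
      · exact ⟨hab, Or.inr ⟨ha', hb'⟩⟩
  · exact le_completeAt (h (ha.2.resolve_right fun h' => hsv h'.1)
      (hb.2.resolve_right fun h' => hsv h'.1) hab)

section Finite

variable [Finite V] {H : SimpleGraph V}

lemma numFree_add_one_le (hv : ¬ IsFreeVertex G v) (hv' : IsFreeVertex H v)
    (h : ∀ s, IsFreeVertex G s → IsFreeVertex H s) : numFree G + 1 ≤ numFree H := by
  rw [numFree, ← Set.ncard_insert_of_notMem (a := v) hv (Set.toFinite _)]
  refine Set.ncard_le_ncard ?_ (Set.toFinite _)
  rintro s (rfl | hs)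
  exacts [hv', h s hs]

lemma numFree_add_two_le {t : V} (hv : ¬ IsFreeVertex G v) (hv' : IsFreeVertex H v)
    (ht : ¬ IsFreeVertex G t) (ht' : IsFreeVertex H t) (htv : t ≠ v)
    (h : ∀ s, IsFreeVertex G s → IsFreeVertex H s) : numFree G + 1 + 1 ≤ numFree H := by
  rw [numFree, ← Set.ncard_insert_of_notMem (a := v) hv (Set.toFinite _),
    ← Set.ncard_insert_of_notMem (a := t) (by rintro (h | h); exacts [htv h, ht h])
      (Set.toFinite _)]
  refine Set.ncard_le_ncard ?_ (Set.toFinite _)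
  rintro s (rfl | rfl | hs)
  exacts [ht', hv', h s hs]

end Finite

/-- Every new edge joins two neighbours of v. A walk with several of them can go to v at the first
and leave v at the last, so the total detour costs only one step. -/
lemma exists_walk_of_walk_completeAt {a b : V} (p : (completeAt G v).Walk a b) :
    (∃ q : G.Walk a b, q.length ≤ p.length) ∨
      ∃ (q : G.Walk a v) (r : G.Walk v b), q.length + r.length ≤ p.length + 1 := by
  induction p with
  | nil => exact Or.inl ⟨Walk.nil, le_rfl⟩
  | @cons a c b hac p ih =>
    rcases hac.2 with hac | ⟨hva, hvc⟩
    · rcases ih with ⟨q, hq⟩ | ⟨q, r, hqr⟩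
      · exact Or.inl ⟨Walk.cons hac q, by simpa using hq⟩
      · exact Or.inr ⟨Walk.cons hac q, r, by simp only [Walk.length_cons]; omega⟩
    · rcases ih with ⟨q, hq⟩ | ⟨q, r, hqr⟩
      · exact Or.inr ⟨Walk.cons hva.symm Walk.nil, Walk.cons hvc q, by
          simp only [Walk.length_cons, Walk.length_nil]; omega⟩
      · by_cases hcv : c = v
        · exact absurd hcv hvc.ne'
        · have hq : 1 ≤ q.length := by
            rcases Nat.eq_zero_or_pos q.length with h0 | h0
            · exact absurd (Walk.eq_of_length_eq_zero h0) hcv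
            · exact h0
          exact Or.inr ⟨Walk.cons hva.symm Walk.nil, r, by
            simp only [Walk.length_cons, Walk.length_nil]; omega⟩

lemma dist_le_dist_completeAt_add_one {a b : V} (h : G.Reachable a b) :
    G.dist a b ≤ (completeAt G v).dist a b + 1 := by
  have hr : (completeAt G v).Reachable a b := h.mono le_completeAt
  obtain ⟨p, hp⟩ := hr.exists_walk_length_eq_dist
  rw [← hp]
  rcases exists_walk_of_walk_completeAt p with ⟨q, hq⟩ | ⟨q, r, hqr⟩
  · exact (dist_le q).trans (hq.trans (Nat.le_succ _))
  · have := dist_le (q.append r)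
    rw [Walk.length_append] at this
    exact this.trans hqr

lemma reachable_of_completeAt_adj {a b : V} (h : (completeAt G v).Adj a b) : G.Reachable a b :=
  h.2.elim Adj.reachable fun h => h.1.reachable.symm.trans h.2.reachable

lemma reachable_isolate_completeAt {a b : V} (h : G.Reachable a b) (ha : a ≠ v) (hb : b ≠ v) :
    (isolate (completeAt G v) v).Reachable a b := by
  obtain ⟨p⟩ := h
  -- A visit to v is bypassed by the new edge between its two neighbours on the walk. The second
  -- clause carries the predecessor c across that visit.
  have key : ∀ {a b : V} (p : G.Walk a b), b ≠ v →
      (a ≠ v → (isolate (completeAt G v) v).Reachable a b) ∧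
      (a = v → ∀ c, G.Adj v c → (isolate (completeAt G v) v).Reachable c b) := by
    intro a b p
    induction p with
    | nil => exact fun hb => ⟨fun _ => Reachable.refl _, fun h => absurd h hb⟩
    | @cons a d b had p ih =>
      intro hb
      obtain ⟨ih1, ih2⟩ := ih hb
      constructor
      · intro hav
        by_cases hdv : d = v
        · exact ih2 hdv a (hdv ▸ had.symm)
        · have hadj : (isolate (completeAt G v) v).Adj a d := ⟨le_completeAt had, hav, hdv⟩
          exact hadj.reachable.trans (ih1 hdv)
      · rintro rfl c hc
        have hda : d ≠ a := had.ne'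
        by_cases hcd : c = d
        · exact hcd ▸ ih1 hda
        · have hadj : (isolate (completeAt G a) a).Adj c d :=
            ⟨⟨hcd, Or.inr ⟨hc, had⟩⟩, hc.ne', hda⟩
          exact hadj.reachable.trans (ih1 hda)
  exact (key p hb).1 ha

lemma exists_adj_dist_eq {a b : V} {n : ℕ} (h : G.dist a b = n + 1) :
    ∃ c, G.Adj a c ∧ G.dist c b = n ∧ G.Reachable c b := by
  have hr : G.Reachable a b := Reachable.of_dist_ne_zero (by omega)
  obtain ⟨p, hp⟩ := hr.exists_walk_length_eq_dist
  cases p with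
  | nil => simp at h
  | @cons _ c _ hac p =>
    refine ⟨c, hac, ?_, p.reachable⟩
    have h1 := dist_le p
    have h2 := Reachable.dist_triangle_left hac.reachable b
    rw [dist_eq_one_iff_adj.2 hac] at h2
    rw [Walk.length_cons] at hp
    omega

/-- Along a geodesic from a the distance to b drops strictly below that of v, so the geodesic avoids
v. -/
lemma reachable_isolate_of_dist_le {a b : V} (h : G.Reachable a b) (hav : a ≠ v)
    (hd : G.dist a b ≤ G.dist v b) : (isolate G v).Reachable a b := by
  induction hn : G.dist a b generalizing a with
  | zero =>
    rw [h.dist_eq_zero_iff.1 hn]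
  | succ n ih =>
    obtain ⟨c, hac, hc, hcb⟩ := exists_adj_dist_eq hn
    have hcv : c ≠ v := by rintro rfl; omega
    have hadj : (isolate G v).Adj a c := ⟨hac, hav, hcv⟩
    exact hadj.reachable.trans (ih hcb hcv (by omega) hc)

lemma exists_not_adj_of_not_isFreeVertex (h : ¬ IsFreeVertex G v) :
    ∃ a b, G.Adj v a ∧ G.Adj v b ∧ a ≠ b ∧ ¬ G.Adj a b := by
  by_contra! hcon
  exact h fun a ha b hb hab => hcon a b ha hb hab

lemma not_isFreeVertex_of_dist {a b w : V} {n : ℕ} (hav : G.Adj a v) (hvb : G.Adj v b)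
    (ha : G.dist a w = n + 2) (hb : G.dist b w = n) : ¬ IsFreeVertex G v := by
  intro h
  have hab : a ≠ b := by rintro rfl; omega
  have := Reachable.dist_triangle_left (h hav.symm hvb hab).reachable w
  rw [dist_eq_one_iff_adj.2 (h hav.symm hvb hab)] at this
  omega

end Selection

/-! ### Choice of a vertex along which `ξ` behaves well -/

section GoodVertex

open SimpleGraph

variable {V : Type*} {G : SimpleGraph V} {v : V}

lemma not_isIsolated_of_not_isFreeVertex (h : ¬ IsFreeVertex G v) : ¬ G.IsIsolated v := by
  obtain ⟨a, -, ha, -⟩ := exists_not_adj_of_not_isFreeVertex h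
  exact fun h => h a ha

lemma completeAt_adj_iff {a b : V} (h : ¬ G.Reachable v a) :
    (completeAt G v).Adj a b ↔ G.Adj a b :=
  ⟨fun hab => hab.2.resolve_right fun h' => h h'.1.reachable, fun hab => le_completeAt hab⟩

lemma isolate_adj_iff {a b : V} (h : ¬ G.Reachable v a) : (isolate G v).Adj a b ↔ G.Adj a b := by
  refine ⟨fun hab => hab.1, fun hab => ⟨hab, ?_, ?_⟩⟩
  · rintro rfl; exact h (Reachable.refl _)
  · rintro rfl; exact h hab.symm.reachable

lemma isolate_completeAt_adj_iff {a b : V} (h : ¬ G.Reachable v a) :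
    (isolate (completeAt G v) v).Adj a b ↔ G.Adj a b := by
  refine ⟨fun hab => (completeAt_adj_iff h).1 hab.1, fun hab =>
    ⟨le_completeAt hab, ((isolate_adj_iff h).2 hab).2⟩⟩

lemma eq_of_reachable_isolate {a : V} (h : (isolate G v).Reachable a v) : a = v :=
  (eq_of_reachable_of_isIsolated isIsolated_isolate h.symm).symm

variable [Finite V]

lemma xi_le_xi_completeAt (hv : ¬ IsFreeVertex G v) : xi G ≤ xi (completeAt G v) := by
  obtain ⟨a, b, ha, hb, hd⟩ := exists_diam_le_dist (G.connectedComponentMk v)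
  have hva : G.Reachable v a := (ConnectedComponent.eq.1 ha).symm
  have hab : G.Reachable a b := ConnectedComponent.eq.1 (ha.trans hb.symm)
  have h := diamSum_add_sum_weight_le (H := completeAt G v)
    (not_isIsolated_of_not_isFreeVertex hv) (fun c d hc => completeAt_adj_iff hc)
    (fun c d hcd => reachable_of_completeAt_adj hcd) (κ := Unit) (fun _ => a) (fun _ => b)
    (fun _ => hva) (fun _ => hab.mono le_completeAt) (fun _ _ _ => rfl)
  rw [Fintype.sum_unique] at h
  have h1 := dist_le_dist_completeAt_add_one (v := v) hab
  have h2 := dist_le_weight (completeAt G v) a b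
  have h3 := numFree_add_one_le hv isFreeVertex_completeAt_self fun s => IsFreeVertex.completeAt
  rw [xi, xi]
  omega

variable {a b : V}

/-- The vertex v gains one as a free vertex and one as an isolated vertex, while the distance of the
diametral pair drops by at most one. -/
lemma xi_add_one_le_xi_isolate_completeAt (hv : ¬ IsFreeVertex G v) (hva : G.Reachable v a)
    (hab : G.Reachable a b) (ha : a ≠ v) (hb : b ≠ v)
    (hd : (G.connectedComponentMk v).toSimpleGraph.diam ≤ G.dist a b) :
    xi G + 1 ≤ xi (isolate (completeAt G v) v) := by
  have hr := reachable_isolate_completeAt hab ha hb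
  have h := diamSum_add_sum_weight_le (H := isolate (completeAt G v) v)
    (not_isIsolated_of_not_isFreeVertex hv) (fun c d hc => isolate_completeAt_adj_iff hc)
    (fun c d hcd => reachable_of_completeAt_adj hcd.1) (κ := Fin 2) ![v, a] ![v, b]
    (by simp [Fin.forall_fin_two, hva]) (by simp [Fin.forall_fin_two, hr]) (by
      simp only [Fin.forall_fin_two, Matrix.cons_val_zero, Matrix.cons_val_one]
      refine ⟨⟨fun _ => trivial, fun h => ?_⟩, fun h => ?_, fun _ => trivial⟩
      · exact absurd (eq_of_reachable_isolate h.symm) ha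
      · exact absurd (eq_of_reachable_isolate h) ha)
  simp only [Fin.sum_univ_two, Matrix.cons_val_zero, Matrix.cons_val_one] at h
  have h1 := dist_le_dist_completeAt_add_one (v := v) hab
  have h2 := dist_le_weight (isolate (completeAt G v) v) a b
  have h3 : numFree G + 1 ≤ numFree (isolate (completeAt G v) v) :=
    numFree_add_one_le hv isFreeVertex_isolate_self fun s hs => hs.completeAt.isolate
  have h4 := weight_of_isIsolated (isIsolated_isolate (G := completeAt G v) (v := v))
  have h5 := hr.dist_anti (isolate_le (G := completeAt G v) (v := v))
  rw [xi, xi]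
  omega

lemma xi_add_two_le_of_reachable (hv : ¬ IsFreeVertex G v) (hva : G.Reachable v a)
    (hr : (isolate G v).Reachable a b) (ha : a ≠ v)
    (hd : (G.connectedComponentMk v).toSimpleGraph.diam ≤ G.dist a b) :
    xi G + 2 ≤ xi (isolate G v) := by
  have h := diamSum_add_sum_weight_le (H := isolate G v)
    (not_isIsolated_of_not_isFreeVertex hv) (fun c d hc => isolate_adj_iff hc)
    (fun c d hcd => hcd.1.reachable) (κ := Fin 2) ![v, a] ![v, b]
    (by simp [Fin.forall_fin_two, hva]) (by simp [Fin.forall_fin_two, hr]) (by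
      simp only [Fin.forall_fin_two, Matrix.cons_val_zero, Matrix.cons_val_one]
      refine ⟨⟨fun _ => trivial, fun h => ?_⟩, fun h => ?_, fun _ => trivial⟩
      · exact absurd (eq_of_reachable_isolate h.symm) ha
      · exact absurd (eq_of_reachable_isolate h) ha)
  simp only [Fin.sum_univ_two, Matrix.cons_val_zero, Matrix.cons_val_one] at h
  have h2 := dist_le_weight (isolate G v) a b
  have h3 : numFree G + 1 ≤ numFree (isolate G v) :=
    numFree_add_one_le hv isFreeVertex_isolate_self fun s hs => hs.isolate
  have h4 := weight_of_isIsolated (isIsolated_isolate (G := G) (v := v))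
  have h5 := hr.dist_anti (isolate_le (G := G) (v := v))
  rw [xi, xi]
  omega

/-- For a cut vertex v: two pairs on different sides, plus g free vertices gained besides v, must
make up for the diameter that is lost. -/
lemma xi_add_two_le_of_pairs (hv : ¬ IsFreeVertex G v) {a' b' : V} (hva : G.Reachable v a)
    (hva' : G.Reachable v a') (hab : (isolate G v).Reachable a b)
    (hab' : (isolate G v).Reachable a' b') (hsep : ¬ (isolate G v).Reachable a a')
    (ha : a ≠ v) (ha' : a' ≠ v) {g : ℕ} (hg : numFree G + 1 + g ≤ numFree (isolate G v))
    (hd : (G.connectedComponentMk v).toSimpleGraph.diam ≤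
      weight (isolate G v) a b + weight (isolate G v) a' b' + g) :
    xi G + 2 ≤ xi (isolate G v) := by
  have h := diamSum_add_sum_weight_le (H := isolate G v)
    (not_isIsolated_of_not_isFreeVertex hv) (fun c d hc => isolate_adj_iff hc)
    (fun c d hcd => hcd.1.reachable) (κ := Fin 3) ![v, a, a'] ![v, b, b']
    (by simp [Fin.forall_fin_succ, hva, hva']) (by simp [Fin.forall_fin_succ, hab, hab']) (by
      have h1 : ¬ (isolate G v).Reachable a v := fun h => ha (eq_of_reachable_isolate h)
      have h2 : ¬ (isolate G v).Reachable a' v := fun h => ha' (eq_of_reachable_isolate h)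
      have h1' : ¬ (isolate G v).Reachable v a := fun h => h1 h.symm
      have h2' : ¬ (isolate G v).Reachable v a' := fun h => h2 h.symm
      have h3' : ¬ (isolate G v).Reachable a' a := fun h => hsep h.symm
      simp [Fin.forall_fin_succ, h1, h2, h1', h2', h3', hsep])
  simp only [Fin.sum_univ_three, Matrix.cons_val_zero, Matrix.cons_val_one,
    Matrix.cons_val_two, Matrix.head_cons, Matrix.tail_cons] at h
  have h4 := weight_of_isIsolated (isIsolated_isolate (G := G) (v := v))
  rw [xi, xi]
  change _ + (_ + _ + weight (isolate G v) a' b') ≤ _ at h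
  omega

/-- In a component of diameter at least two there is a non-free vertex, different from the two given
vertices at maximal distance, whose isolation raises `ξ` by at least two. -/
lemma exists_xi_add_two_le {u w : V} {d : ℕ} (huw : G.dist u w = d + 2)
    (hd : (G.connectedComponentMk u).toSimpleGraph.diam ≤ d + 2) :
    ∃ v, ¬ IsFreeVertex G v ∧ G.Reachable v u ∧ u ≠ v ∧ w ≠ v ∧
      xi G + 2 ≤ xi (isolate G v) := by
  by_contra! hcon
  have hcomp : ∀ {v}, G.Reachable v u →
      (G.connectedComponentMk v).toSimpleGraph.diam ≤ d + 2 := by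
    intro v h
    rwa [ConnectedComponent.sound h]
  have hru : G.Reachable u w := Reachable.of_dist_ne_zero (by omega)
  -- If isolating v left u and w connected, their distance would not shrink and v would already be
  -- as required. So every candidate separates u from w.
  have hsep : ∀ v, ¬ IsFreeVertex G v → G.Reachable v u → u ≠ v → w ≠ v →
      ¬ (isolate G v).Reachable u w := fun v h1 h2 h3 h4 h5 =>
    absurd (xi_add_two_le_of_reachable h1 h2 h5 h3 (huw ▸ hcomp h2)) (hcon v h1 h2 h3 h4).not_ge
  have hfree1 : ∀ {v}, ¬ IsFreeVertex G v → numFree G + 1 + 0 ≤ numFree (isolate G v) := fun hv =>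
    numFree_add_one_le hv isFreeVertex_isolate_self fun s hs => hs.isolate
  have hfree2 : ∀ {v t}, ¬ IsFreeVertex G v → ¬ IsFreeVertex G t → t ≠ v →
      IsFreeVertex (isolate G v) t → numFree G + 1 + 1 ≤ numFree (isolate G v) :=
    fun hv ht htv ht' => numFree_add_two_le hv isFreeVertex_isolate_self ht ht' htv
      fun s hs => hs.isolate
  -- The vertices u, a, b, c, e, … of a geodesic to w are taken one by one. Each interior one is
  -- non-free, since its two neighbours on the geodesic are at distance 2.
  obtain ⟨a, hua, haw, hraw⟩ := exists_adj_dist_eq huw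
  obtain ⟨b, hab, hbw, hrbw⟩ := exists_adj_dist_eq haw
  have ha := not_isFreeVertex_of_dist hua hab huw hbw
  have hau : G.Reachable a u := hua.symm.reachable
  have hwa : w ≠ a := by rintro rfl; simp at haw
  have hba : b ≠ a := hab.ne'
  have hSa := hsep a ha hau hua.ne hwa
  have hbwa : (isolate G a).Reachable b w := reachable_isolate_of_dist_le hrbw hba (by omega)
  obtain ⟨y, huy, hy⟩ := exists_one_le_weight (isolate G a) u
  -- any pair on the far side of `a` is too close
  have hfar : ∀ c e g, (isolate G a).Reachable c w → (isolate G a).Reachable c e →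
      numFree G + 1 + g ≤ numFree (isolate G a) → weight (isolate G a) c e + g < d + 1 := by
    intro c e g hcw hce hg
    by_contra! hlt
    have hca : c ≠ a := by
      rintro rfl
      exact hwa (eq_of_reachable_isolate hcw.symm)
    refine (hcon a ha hau hua.ne hwa).not_ge (xi_add_two_le_of_pairs ha hau
      (hau.trans (hru.trans (hcw.mono isolate_le).symm)) huy hce
      (fun h => hSa (h.trans hcw)) hua.ne hca hg ?_)
    have := hcomp hau
    omega
  rcases d with _ | d
  · obtain ⟨z, hwz, hz⟩ := exists_one_le_weight (isolate G a) w
    have := hfar w z 0 (Reachable.refl _) hwz (hfree1 ha)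
    omega
  obtain ⟨c, hbc, hcw, hrcw⟩ := exists_adj_dist_eq hbw
  have hb := not_isFreeVertex_of_dist hab hbc haw hcw
  have hwb : w ≠ b := by rintro rfl; simp at hbw
  have hub : u ≠ b := by rintro rfl; omega
  have hbu : G.Reachable b u := hab.symm.reachable.trans hau
  have hSb := hsep b hb hbu hub hwb
  have hbw' : d + 1 ≤ weight (isolate G a) b w :=
    (hbw ▸ hbwa.dist_anti isolate_le).trans (dist_le_weight _ _ _)
  by_cases hbfree : IsFreeVertex (isolate G a) b
  · have := hfar b w 1 hbwa hbwa (hfree2 ha hb hba hbfree)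
    omega
  -- The pair (b, w) falls short by just one, and b becoming free would supply it. So b keeps two
  -- non-adjacent neighbours away from a.
  obtain ⟨q, q', hbq, hbq', hqq', hnadj⟩ := exists_not_adj_of_not_isFreeVertex hbfree
  rcases d with _ | d
  · have hrq : (isolate G a).Reachable q q' := hbq.symm.reachable.trans hbq'.reachable
    have h1 := hrq.one_lt_dist_of_ne_of_not_adj hqq' hnadj
    have h2 := hfar q q' 0 (hbq.symm.reachable.trans hbwa) hrq (hfree1 ha)
    have h3 := dist_le_weight (isolate G a) q q'
    omega
  obtain ⟨e, hce, hew, hrew⟩ := exists_adj_dist_eq hcw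
  have hc := not_isFreeVertex_of_dist hbc hce hbw hew
  have hwc : w ≠ c := by rintro rfl; simp at hcw
  have huc : u ≠ c := by rintro rfl; omega
  have hac : a ≠ c := by rintro rfl; omega
  have hcu : G.Reachable c u := hbc.symm.reachable.trans hbu
  have hSc := hsep c hc hcu huc hwc
  clear hnadj
  wlog hqc : q ≠ c generalizing q q'
  · exact this q' q hbq' hbq hqq'.symm (by push Not at hqc; rw [← hqc]; exact hqq'.symm)
  -- Now d(u, w) = d + 4 and d(b, w) = d + 2. The distance from q to w is exactly d + 2: a larger
  -- one contradicts `hfar`, and a smaller one gives a path u, a, b, q, …, w avoiding c. Since q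
  -- also reaches w without b, isolating b leaves weight d + 2 on the side of w.
  have hqw : G.dist q w ≤ d + 2 := by
    by_contra! hlt
    have hrq : (isolate G a).Reachable q w := hbq.symm.reachable.trans hbwa
    have h2 := hfar q w 0 hrq hrq (hfree1 ha)
    have h3 := hrq.dist_anti (isolate_le (G := G) (v := a))
    have h4 := dist_le_weight (isolate G a) q w
    omega
  have hrqw : G.Reachable q w := hbq.1.symm.reachable.trans hrbw
  have hqb : (isolate G b).Reachable q w :=
    reachable_isolate_of_dist_le hrqw hbq.1.ne' (by omega)
  have hqw' : d + 2 ≤ G.dist q w := by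
    by_contra! hlt
    have h1 : (isolate G c).Reachable q w := reachable_isolate_of_dist_le hrqw hqc (by omega)
    have h2 : (isolate G c).Adj u a := ⟨hua, huc, hac⟩
    have h3 : (isolate G c).Adj a b := ⟨hab, hac, hbc.ne⟩
    have h4 : (isolate G c).Adj b q := ⟨hbq.1, hbc.ne, hqc⟩
    exact hSc (h2.reachable.trans (h3.reachable.trans (h4.reachable.trans h1)))
  have hqw'' := hqb.dist_anti (isolate_le (G := G) (v := b))
  have hqw3 := dist_le_weight (isolate G b) q w
  have huab : (isolate G b).Adj u a := ⟨hua, hub, hab.ne⟩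
  -- any pair on the near side of `b` is too close
  have hnear : ∀ s t g, (isolate G b).Reachable u s → (isolate G b).Reachable s t →
      numFree G + 1 + g ≤ numFree (isolate G b) → weight (isolate G b) s t + g < 2 := by
    intro s t g hus hst hg
    by_contra! hlt
    have hsb : s ≠ b := by
      rintro rfl
      exact hub (eq_of_reachable_isolate hus)
    refine (hcon b hb hbu hub hwb).not_ge (xi_add_two_le_of_pairs hb
      (hbu.trans (hus.mono isolate_le)) hbq.1.reachable hst hqb
      (fun h => hSb (hus.trans (h.trans hqb))) hsb hbq.1.ne' hg ?_)
    have := hcomp hbu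
    omega
  -- The side of u always has the missing 2: either the edge from u to a together with a becoming
  -- free, or two non-adjacent neighbours of a.
  by_cases hafree : IsFreeVertex (isolate G b) a
  · have h1 := hnear u a 1 (Reachable.refl _) huab.reachable (hfree2 hb ha hab.ne hafree)
    have h2 := dist_le_weight (isolate G b) u a
    rw [dist_eq_one_iff_adj.2 huab] at h2
    omega
  · obtain ⟨r, r', har, har', hrr', hnadj⟩ := exists_not_adj_of_not_isFreeVertex hafree
    have hr : (isolate G b).Reachable r r' := har.symm.reachable.trans har'.reachable
    have h1 := hr.one_lt_dist_of_ne_of_not_adj hrr' hnadj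
    have h2 := hnear r r' 0 (huab.reachable.trans har.reachable) hr (hfree1 hb)
    have h3 := dist_le_weight (isolate G b) r r'
    omega

theorem exists_vertex_xi_le (hG : ∃ v, ¬ IsFreeVertex G v) :
    ∃ v, ¬ IsFreeVertex G v ∧ xi G ≤ xi (completeAt G v) ∧ xi G + 2 ≤ xi (isolate G v) ∧
      xi G + 1 ≤ xi (isolate (completeAt G v) v) := by
  obtain ⟨v₀, hv₀⟩ := hG
  obtain ⟨u, w, hu, hw, hd⟩ := exists_diam_le_dist (G.connectedComponentMk v₀)
  have huw : G.Reachable u w := ConnectedComponent.eq.1 (hu.trans hw.symm)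
  rw [← hu] at hd
  have htwo : 2 ≤ G.dist u w := by
    obtain ⟨a, b, ha, hb, hab, hnadj⟩ := exists_not_adj_of_not_isFreeVertex hv₀
    have hr := ha.symm.reachable.trans hb.reachable
    have h1 := hr.one_lt_dist_of_ne_of_not_adj hab hnadj
    have h2 := dist_le_diam_component hr
    rw [← ConnectedComponent.sound ha.reachable, ← hu] at h2
    omega
  obtain ⟨d, hd'⟩ := Nat.exists_eq_add_of_le' htwo
  obtain ⟨v, hv, hvu, huv, hwv, h⟩ := exists_xi_add_two_le hd' (hd' ▸ hd)
  refine ⟨v, hv, xi_le_xi_completeAt hv, h,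
    xi_add_one_le_xi_isolate_completeAt hv hvu huw huv hwv ?_⟩
  rwa [ConnectedComponent.sound hvu]

end GoodVertex

/-! ### The depth bound -/

section Bound

variable {K : Type u} [Field K] {V : Type} [Fintype V] [DecidableEq V]

lemma graphIdeal_eq_clusterIdeal {W : Finset V} {G : SimpleGraph V}
    (hW : ∀ i j, G.Adj i j → i ∈ W) (hfree : ∀ v, IsFreeVertex G v) :
    graphIdeal K W G = clusterIdeal K (Finset.univ.filter fun s => vertexOf s ∉ W) W
      G.connectedComponentMk := by
  apply le_antisymm
  · refine graphIdeal_le (fun s hs => X_mem_clusterIdeal (by simpa using hs)) fun i j h => ?_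
    exact binomial_mem_clusterIdeal (hW i j h) (hW j i h.symm)
      (SimpleGraph.ConnectedComponent.sound h.reachable)
  · refine clusterIdeal_le (fun s hs => X_mem_graphIdeal (by simpa using hs)) fun i _ j _ h => ?_
    rcases eq_or_adj_of_reachable hfree (SimpleGraph.ConnectedComponent.eq.1 h) with rfl | h
    · rw [sub_self]; exact zero_mem _
    · exact binomial_mem_graphIdeal h

/-- A vertex outside W accounts for at most one free vertex and one component, hence the factor 2.
-/
lemma xi_le_clusterDim {W : Finset V} {G : SimpleGraph V} [DecidableEq G.ConnectedComponent]
    (hfree : ∀ v, IsFreeVertex G v) :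
    xi G ≤ clusterDim (Finset.univ.filter fun s => vertexOf s ∉ W) W G.connectedComponentMk +
      2 * Wᶜ.card := by
  have := Fintype.ofFinite G.ConnectedComponent
  have h1 : numFree G ≤ W.card + Wᶜ.card := by
    rw [Finset.card_add_card_compl, numFree, ← Nat.card_eq_fintype_card, ← Set.ncard_univ]
    exact Set.ncard_le_ncard (Set.subset_univ _) (Set.toFinite _)
  have h2 : diamSum G ≤ (W.image G.connectedComponentMk).card + Wᶜ.card := by
    refine (diamSum_le_card_of_forall_isFreeVertex hfree).trans ?_
    rw [Nat.card_eq_fintype_card, ← Finset.card_univ]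
    refine (Finset.card_le_card (t := W.image G.connectedComponentMk ∪
      Wᶜ.image G.connectedComponentMk) fun C _ => ?_).trans
      ((Finset.card_union_le _ _).trans (Nat.add_le_add_left Finset.card_image_le _))
    induction C using SimpleGraph.ConnectedComponent.ind with
    | _ v =>
      rw [← Finset.image_union, Finset.union_compl]
      exact Finset.mem_image_of_mem _ (Finset.mem_univ v)
  rw [xi, clusterDim]
  omega

/-- Vertices outside W are isolated and their variables are killed, so their contribution 2 to ξ is
subtracted. The induction is on the number of non-free vertices. Passing from W to `W.erase v` costs
2, which matches the gain 2 for `isolate G v`. It exceeds the gain 1 for the sum ideal by one, and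
there the depth lemma needs one less. -/
theorem extVanish_graphIdeal (W : Finset V) (G : SimpleGraph V)
    (hW : ∀ i j, G.Adj i j → i ∈ W) {k : ℕ} (hk : k + 2 * Wᶜ.card ≤ xi G) :
    ExtVanish (homogeneousMaximalIdeal K V) k (PolyRing K V ⧸ graphIdeal K W G) := by
  classical
  induction hn : {v | ¬ IsFreeVertex G v}.ncard using Nat.strong_induction_on
    generalizing W G k with
  | _ n ih =>
  by_cases hfree : ∀ v, IsFreeVertex G v
  · rw [graphIdeal_eq_clusterIdeal hW hfree]
    refine (extVanish_clusterIdeal _ W _ (fun s hs => by simpa using hs)).mono ?_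
    have := xi_le_clusterDim (W := W) hfree
    omega
  push Not at hfree
  obtain ⟨v, hv, h1, h2, h3⟩ := exists_vertex_xi_le hfree
  have hlt : ∀ H : SimpleGraph V, IsFreeVertex H v →
      (∀ s, IsFreeVertex G s → IsFreeVertex H s) → {v | ¬ IsFreeVertex H v}.ncard < n := by
    intro H hvH hH
    rw [← hn]
    refine Set.ncard_lt_ncard ⟨fun s hs hs' => hs (hH s hs'), fun h => h hv hvH⟩ (Set.toFinite _)
  rcases k with _ | k
  · exact extVanish_zero _ _
  have hvW : v ∈ W := by
    obtain ⟨a, -, ha, -⟩ := exists_not_adj_of_not_isFreeVertex hv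
    exact hW v a ha
  have hcard : (W.erase v)ᶜ.card = Wᶜ.card + 1 := by
    rw [Finset.compl_erase, Finset.card_insert_of_notMem (by simpa using hvW)]
  have hWc : ∀ i j, (completeAt G v).Adj i j → i ∈ W := fun i j h =>
    h.2.elim (hW i j) fun h' => hW i v h'.1.symm
  refine ExtVanish.quotient_inf (graphIdeal_eq_inf W G v) ?_ ?_ ?_
  · exact ih _ (hlt _ isFreeVertex_completeAt_self fun s => IsFreeVertex.completeAt) W _ hWc
      (hk.trans h1) rfl
  · refine ih _ (hlt _ isFreeVertex_isolate_self fun s hs => hs.isolate) _ (isolate G v)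
      (fun i j h => Finset.mem_erase.2 ⟨h.2.1, hW i j h.1⟩) ?_ rfl
    omega
  · rw [graphIdeal_sup]
    refine ih _ (hlt _ isFreeVertex_isolate_self fun s hs => hs.completeAt.isolate) _
      (isolate (completeAt G v) v)
      (fun i j h => Finset.mem_erase.2 ⟨h.2.1, hWc i j h.1⟩) ?_ rfl
    omega

theorem xi_le_depthQuotient (G : SimpleGraph V) : (xi G : ℕ∞) ≤ depthQuotient K G := by
  have h := extVanish_graphIdeal (K := K) Finset.univ G (fun i _ _ => Finset.mem_univ i)
    (k := xi G) (by simp)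
  rw [graphIdeal_univ] at h
  exact le_depth_of_extVanish h

omit [DecidableEq V] in
lemma diam_le_diamSum {G : SimpleGraph V} (hG : G.Connected) : G.diam ≤ diamSum G := by
  have := hG.nonempty
  obtain ⟨u, w, huw⟩ := G.exists_dist_eq_diam
  have h := sum_weight_le_diamSum (ι := Unit) (fun _ => u) (fun _ => w) (fun _ => hG u w)
    fun _ _ _ => rfl
  rw [Fintype.sum_unique] at h
  exact huw ▸ (dist_le_weight G u w).trans h

end Bound

end BinomialEdge

end

theorem theorem3p4 (K : Type u) [Field K] (n : ℕ) (G : SimpleGraph (Fin n)) :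
    (BinomialEdge.xi G : ℕ∞) ≤ BinomialEdge.depthQuotient K G ∧
      (G.Connected →
        ((BinomialEdge.numFree G + G.diam : ℕ) : ℕ∞) ≤ BinomialEdge.depthQuotient K G) := by
  refine ⟨BinomialEdge.xi_le_depthQuotient G, fun hG => ?_⟩
  refine le_trans ?_ (BinomialEdge.xi_le_depthQuotient G)
  exact_mod_cast Nat.add_le_add_left (BinomialEdge.diam_le_diamSum hG) _
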